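/- Let $d\ge 1$ and let $\mathbb P$ be the law of Bernoulli site percolation $\omega\in\{0,1\}^{\mathbb Z^d}$ on the nearest-neighbour lattice $\mathbb{Z}^d$ with parameter $0<p<p_c(d)$, where $p_c(d)$ is the supremum of the parameters for which almost surely all open clusters are finite. Let $C_x$ be the number of sites in the open cluster of $x$ ($C_x=0$ if $x$ is closed), and let $\xi=-\limsup_{n\to\infty}\frac1n\ln\mathbb P(C_0\ge n)$ be the exponential decay rate of the cluster size (the upper limit is the limit whenever the latter exists). Let $\ell\in\mathbb R^d$ be a Euclidean unit vector and let $\lambda\ge 0$, $\beta\ge 0$. Given $\omega$, let $P_\omega$ be the law of the right-continuous continuous-time Markov chain $Y=(Y_t)_{t\ge0}$ on $\mathbb Z^d$ with $Y_0=0$ and generator $$Lf(x)=K\sum_{\|e\|_1=1}e^{\lambda\,\ell\cdot e-\beta C_x}\,[f(x+e)-f(x)],\qquad K=\Big(\sum_{\|e\|_1=1}e^{\lambda\,\ell\cdot e}\Big)^{-1},$$ and let $P=\mathbb P\times P_\omega$ be the annealed law, under which $\omega$ has law $\mathbb P$ and $Y$ has conditional law $P_\omega$ given $\omega$. Then $$\frac{Y_t}{t}\xrightarrow[t\to+\infty]{}v(\lambda,\beta)\quad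 P\text{-a.s.},\qquad v(\lambda,\beta)=\big(\mathbb E\,e^{\beta C_0}\big)^{-1}d(\lambda),\qquad d(\lambda)=\frac{1}{\sum_{k=1}^d\cosh(\lambda\ell_k)}\big(\sinh(\lambda\ell_k)\big)_{1\le k\le d},$$ where $(+\infty)^{-1}=0$. In particular, $v(\lambda,\beta)=0$ if $\beta>\xi$ or $\lambda=0$, while $v(\lambda,\beta)\cdot\ell>0$ if $\beta<\xi$ and $\lambda\ne0$. -/

import Mathlib

open MeasureTheory ProbabilityTheory Filter Topology unitInterval
open scoped ENNReal NNReal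

noncomputable section

namespace PercolationWalk

/-! ### The lattice and Bernoulli site percolation -/

/-- The vertices of the lattice `ℤ^d`. -/
abbrev Site (d : ℕ) : Type := Fin d → ℤ

/-- The nearest-neighbour graph: `x ∼ y` when `‖x - y‖₁ = 1`. -/
def lattice (d : ℕ) : SimpleGraph (Site d) where
  Adj x y := ∑ i, |x i - y i| = 1
  symm := ⟨fun x y h => by simpa only [abs_sub_comm] using h⟩
  loopless := ⟨fun x h => by simp at h⟩

/-- The finite set of the neighbours `e ∼ 0` of the origin. -/
def unitSteps (d : ℕ) : Finset (Site d) :=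
  (Finset.Icc (-1) 1).filter fun e => ∑ i, |e i| = 1

theorem mem_unitSteps {d : ℕ} {e : Site d} : e ∈ unitSteps d ↔ (lattice d).Adj 0 e := by
  simp only [unitSteps, lattice, Finset.mem_filter, Finset.mem_Icc, Pi.zero_apply, zero_sub,
    abs_neg, and_iff_right_iff_imp]
  intro h
  have key : ∀ i, |e i| ≤ 1 := fun i =>
    h ▸ Finset.single_le_sum (f := fun i => |e i|) (fun j _ => abs_nonneg _) (Finset.mem_univ i)
  exact ⟨fun i => (abs_le.mp (key i)).1, fun i => (abs_le.mp (key i)).2⟩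

/-- Environments; the site `x` is open in `ω` when `ω x = true`. -/
abbrev Env (d : ℕ) : Type := Site d → Bool

/-- The law `ℙ` of the environment: all sites are independently open with probability `p`. -/
def percLaw (d : ℕ) (p : I) : Measure (Env d) :=
  Measure.infinitePi fun _ : Site d => bernoulliMeasure true false p

instance (d : ℕ) (p : I) : IsProbabilityMeasure (percLaw d p) := by
  unfold percLaw; infer_instance

/-- The open cluster of `x`: the endpoints of the paths from `x` all of whose vertices
(including `x` itself) are open. It is empty when `x` is closed. -/
def cluster {d : ℕ} (ω : Env d) (x : Site d) : Set (Site d) :=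
  {y | ∃ w : (lattice d).Walk x y, ∀ u ∈ w.support, ω u = true}

/-- `C_x`, the number of sites in the open cluster of `x`. -/
def clusterSize {d : ℕ} (ω : Env d) (x : Site d) : ℕ∞ := (cluster ω x).encard

/-- The critical probability: the supremum of the `p` for which almost surely all open
clusters are finite. -/
def criticalProb (d : ℕ) : I :=
  sSup {p : I | ∀ᵐ ω ∂(percLaw d p), ∀ x : Site d, clusterSize ω x ≠ ⊤}

/-- The exponential decay rate `ξ(p)` of the cluster size: `-ξ(p)` is the upper limit (and hence
the limit, if that exists) of `(1 / n) log ℙ(C_0 ≥ n)`. -/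
def decayRate (d : ℕ) (p : I) : ℝ :=
  -limsup (fun n : ℕ =>
    (1 / (n : ℝ)) * Real.log ((percLaw d p).real {ω | (n : ℕ∞) ≤ clusterSize ω 0})) atTop

/-- `e^{b C}` as an extended nonnegative real, where `C` may be infinite (with `0 * ∞ = 0`). -/
def expSize (b : ℝ) (C : ℕ∞) : ℝ≥0∞ := EReal.exp ((b : EReal) * ((C : ℝ≥0∞) : EReal))

/-! ### Markov jump processes -/

/-- The rate of jumping from `x` to `y` under the generator `L`: the matrix entry
`L 1_{y} (x)`. -/
def jumpRate {S : Type*} [DecidableEq S] (L : (S → ℝ) → S → ℝ) (x y : S) : ℝ :=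
  L (Pi.single y 1) x

/-- The total rate `- L 1_{x} (x)` of leaving `x`. -/
def exitRate {S : Type*} [DecidableEq S] (L : (S → ℝ) → S → ℝ) (x : S) : ℝ :=
  -jumpRate L x x

/-- The transition matrix of the jump chain of the generator `L`; a site with exit rate zero is
absorbing. -/
def jumpProb {S : Type*} [DecidableEq S] (L : (S → ℝ) → S → ℝ) (x y : S) : ℝ :=
  if exitRate L x = 0 then (if x = y then 1 else 0)
  else if x = y then 0 else jumpRate L x y / exitRate L x

/-- Under `μ` the process `Y` is a continuous time Markov chain with generator `L` and initial
state `x₀` (up to its explosion time, which is infinite when the exit rates are bounded):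
its successive states `X 0, X 1, …` form a Markov chain with transition matrix `jumpProb L`
and initial state `x₀`, and, given these states, the successive holding times `τ 0, τ 1, …` are
independent, `τ i` being exponential with rate `exitRate L (X i)` (infinite if the rate is
zero). -/
structure IsMarkovJumpProcess {S Ω' : Type*} [DecidableEq S] [MeasurableSpace S]
    [MeasurableSpace Ω'] (L : (S → ℝ) → S → ℝ) (x₀ : S) (μ : Measure Ω')
    (Y : ℝ≥0 → Ω' → S) : Prop where
  exists_chain : ∃ (X : ℕ → Ω' → S) (τ : ℕ → Ω' → ℝ≥0∞),
    (∀ n, Measurable (X n)) ∧ (∀ n, Measurable (τ n)) ∧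
    (∀ (n : ℕ) (x : ℕ → S) (t : ℕ → ℝ≥0),
      μ {z | ∀ i ≤ n, X i z = x i ∧ (t i : ℝ≥0∞) < τ i z} =
        if x 0 = x₀ then
          ENNReal.ofReal ((∏ i ∈ Finset.range n, jumpProb L (x i) (x (i + 1))) *
            ∏ i ∈ Finset.range (n + 1), Real.exp (-exitRate L (x i) * t i))
        else 0) ∧
    ∀ᵐ z ∂μ, ∀ (n : ℕ) (t : ℝ≥0), ∑ i ∈ Finset.range n, τ i z ≤ t →
      (t : ℝ≥0∞) < ∑ i ∈ Finset.range (n + 1), τ i z → Y t z = X n z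

/-! ### The walk -/

/-- `ℓ · x` for a lattice point `x`. -/
def dotSite {d : ℕ} (ℓ : EuclideanSpace ℝ (Fin d)) (x : Site d) : ℝ := ∑ k, ℓ k * (x k : ℝ)

/-- The normalizing constant `K = (∑_{e ∼ 0} e^{lam ℓ·e})⁻¹`. -/
def normConst {d : ℕ} (ℓ : EuclideanSpace ℝ (Fin d)) (lam : ℝ) : ℝ :=
  (∑ e ∈ unitSteps d, Real.exp (lam * dotSite ℓ e))⁻¹

/-- The generator of the walk in the environment `ω`:
`L f (x) = K ∑_{e ∼ 0} e^{lam ℓ·e - β C_x} (f (x + e) - f x)`. -/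
def generator {d : ℕ} (ℓ : EuclideanSpace ℝ (Fin d)) (lam β : ℝ) (ω : Env d)
    (f : Site d → ℝ) (x : Site d) : ℝ :=
  normConst ℓ lam * ∑ e ∈ unitSteps d,
    Real.exp (lam * dotSite ℓ e) * (expSize (-β) (clusterSize ω x)).toReal * (f (x + e) - f x)

/-- The drift of the skeleton walk,
`d(lam) = (∑_k cosh (lam ℓ_k))⁻¹ (sinh (lam ℓ_k))_k`. -/
def drift {d : ℕ} (ℓ : EuclideanSpace ℝ (Fin d)) (lam : ℝ) : EuclideanSpace ℝ (Fin d) :=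
  (∑ k, Real.cosh (lam * ℓ k))⁻¹ • WithLp.toLp 2 fun k => Real.sinh (lam * ℓ k)

/-- The velocity `v(lam, β) = (𝔼 e^{β C_0})⁻¹ d(lam)`, where `∞⁻¹ = 0`. -/
def velocity {d : ℕ} (p : I) (ℓ : EuclideanSpace ℝ (Fin d)) (lam β : ℝ) :
    EuclideanSpace ℝ (Fin d) :=
  ((∫⁻ ω, expSize β (clusterSize ω 0) ∂(percLaw d p))⁻¹).toReal • drift ℓ lam

/-- A lattice point as a vector of Euclidean space. -/
def toVec {d : ℕ} (x : Site d) : EuclideanSpace ℝ (Fin d) := WithLp.toLp 2 fun k => (x k : ℝ)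

end PercolationWalk

end

/-! The factor `e^{-β C_x}` is common to all jumps out of `x`, so it only slows the walk down. The
jump chain is a random walk with i.i.d. steps whose law ignores the environment
(`jumpProb_generator`), and the holding time at `x` is `e^{β C_x}` times a unit exponential
variable. Subcriticality makes all clusters finite almost surely, by a coupling that is monotone in
the parameter, so no site is absorbing.

Since the steps do not depend on `ω`, the environment seen from the jump chain is stationary under
`ℙ` itself: the skew product `skew` on environments and marked steps preserves the product law, and
it is ergodic (`ergodic_skew`). The pointwise ergodic theorem, proved here through a maximal
function and extended to nonnegative functions of infinite integral, then gives two limits: position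
over number of jumps tends to `d(lam)`, and total holding time over number of jumps tends to `𝔼 e^{β
C_0}`, possibly infinite. Counting the jumps up to time `t` turns these into `Y_t / t → (𝔼 e^{β
C_0})⁻¹ d(lam)` (`tendsto_inv_smul_of_jumpChain`).

This concerns one explicit construction. Any process satisfying `IsMarkovJumpProcess` has the same
joint law of states and holding times (`chainLaw_unique`, `map_chain_eq_map_walkChain`), so the
limits transfer to it for almost every `ω`. Right-continuity makes the convergence event measurable,
which allows the passage from quenched to annealed.

The sign statements compare `β` with `ξ`: Markov's inequality makes the exponential moment infinite
above `ξ`, a geometric series bounds it below `ξ`, and `x sinh(lam x) > 0` for `x ≠ 0` gives the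
direction of the drift. -/

noncomputable section

namespace PercolationWalk

/-! ### The pointwise ergodic theorem -/

section Birkhoff

variable {α : Type*} {T : α → α}

/-- The running maximum `max_{k ≤ n} S_k` of the Birkhoff sums of `f`, including `S_0 = 0`. -/
def birkhoffMax (T : α → α) (f : α → ℝ) : ℕ → α → ℝ
  | 0, _ => 0
  | n + 1, x => max 0 (f x + birkhoffMax T f n (T x))

theorem birkhoffMax_nonneg (f : α → ℝ) (n : ℕ) (x : α) : 0 ≤ birkhoffMax T f n x := by
  cases n
  · exact le_rfl
  · exact le_max_left _ _

theorem birkhoffMax_le_succ (f : α → ℝ) (n : ℕ) (x : α) :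
    birkhoffMax T f n x ≤ birkhoffMax T f (n + 1) x := by
  induction n generalizing x with
  | zero => exact le_max_left _ _
  | succ n ih =>
    rw [birkhoffMax, birkhoffMax]
    gcongr
    exact ih _

theorem birkhoffMax_mono (f : α → ℝ) (x : α) : Monotone fun n => birkhoffMax T f n x :=
  monotone_nat_of_le_succ fun n => birkhoffMax_le_succ f n x

theorem birkhoffSum_le_birkhoffMax (f : α → ℝ) (n : ℕ) (x : α) :
    birkhoffSum T f n x ≤ birkhoffMax T f n x := by
  induction n generalizing x with
  | zero => simp [birkhoffMax]
  | succ n ih =>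
    rw [birkhoffSum_succ', birkhoffMax]
    exact le_max_of_le_right (by linarith [ih (T x)])

/-- This increment has nonnegative integral by invariance of the measure, and it equals `f x` as
soon as the maximum at `T x` exceeds `-f x`. The ergodic theorem rests on comparing these two facts.
-/
theorem birkhoffMax_succ_sub (f : α → ℝ) (n : ℕ) (x : α) :
    birkhoffMax T f (n + 1) x - birkhoffMax T f n (T x) = max (-birkhoffMax T f n (T x)) (f x) := by
  rcases max_cases 0 (f x + birkhoffMax T f n (T x)) with h | h <;>
    rcases max_cases (-birkhoffMax T f n (T x)) (f x) with h' | h' <;>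
    rw [birkhoffMax] <;> linarith

/-- The set where the Birkhoff sums are unbounded above. -/
def birkhoffUnbounded (T : α → α) (f : α → ℝ) : Set α :=
  {x | ∀ B : ℕ, ∃ n, (B : ℝ) < birkhoffMax T f n x}

/-- Passing between `x` and `T x` changes the sums only by the fixed amount `f x`, which does not
affect unboundedness. -/
theorem preimage_birkhoffUnbounded (f : α → ℝ) :
    T ⁻¹' birkhoffUnbounded T f = birkhoffUnbounded T f := by
  ext x
  simp only [birkhoffUnbounded, Set.preimage_ofPred_eq, Set.mem_ofPred_eq]
  constructor
  · intro h B
    obtain ⟨C, hC⟩ := exists_nat_gt ((B : ℝ) - f x)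
    obtain ⟨n, hn⟩ := h C
    exact ⟨n + 1, lt_max_of_lt_right (by linarith)⟩
  · intro h B
    obtain ⟨C, hC⟩ := exists_nat_gt (max 0 ((B : ℝ) + f x))
    obtain ⟨n, hn⟩ := h C
    rcases n with _ | n
    · exact absurd hn (by simp [birkhoffMax])
    · refine ⟨n, ?_⟩
      have h1 := (le_max_left _ _).trans_lt hC
      have h2 := (le_max_right _ _).trans_lt hC
      rw [birkhoffMax] at hn
      rcases lt_max_iff.1 hn with h | h <;> linarith

variable [MeasurableSpace α] {μ : Measure α}

theorem integrable_birkhoffMax (hT : MeasurePreserving T μ μ) {f : α → ℝ} (hf : Integrable f μ)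
    (n : ℕ) : Integrable (birkhoffMax T f n) μ := by
  induction n with
  | zero => exact integrable_zero _ _ _
  | succ n ih =>
    have := (integrable_zero α ℝ μ).sup (hf.add ((hT.integrable_comp ih.1).2 ih))
    exact this

theorem measurable_birkhoffMax (hT : Measurable T) {f : α → ℝ} (hf : Measurable f) (n : ℕ) :
    Measurable (birkhoffMax T f n) := by
  induction n with
  | zero => exact measurable_const
  | succ n ih => exact measurable_const.max (hf.add (ih.comp hT))

theorem measurableSet_birkhoffUnbounded (hT : Measurable T) {f : α → ℝ} (hf : Measurable f) :
    MeasurableSet (birkhoffUnbounded T f) := by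
  simp only [birkhoffUnbounded, Set.ofPred_forall, Set.ofPred_exists]
  exact .iInter fun B => .iUnion fun n =>
    measurableSet_lt measurable_const (measurable_birkhoffMax hT hf n)

/-- On the invariant set `A` the increments `max (-M_n ∘ T) f` are dominated by `|f|` and eventually
equal to `f`. Their integrals over `A` are those of `M_{n+1} - M_n ≥ 0`, because `T` preserves the
measure restricted to `A`. -/
theorem setIntegral_birkhoffUnbounded_nonneg (hT : MeasurePreserving T μ μ)
    {f : α → ℝ} (hfm : Measurable f) (hf : Integrable f μ) :
    0 ≤ ∫ x in birkhoffUnbounded T f, f x ∂μ := by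
  set A := birkhoffUnbounded T f with hA
  have hAm : MeasurableSet A := measurableSet_birkhoffUnbounded hT.measurable hfm
  have hTA : MeasurePreserving T (μ.restrict A) (μ.restrict A) := by
    have := hT.restrict_preimage hAm
    rwa [hA, preimage_birkhoffUnbounded] at this
  have hint := fun n => integrable_birkhoffMax hTA (hf.restrict (s := A)) n
  have hlim : Tendsto (fun n => ∫ x in A, max (-birkhoffMax T f n (T x)) (f x) ∂μ) atTop
      (𝓝 (∫ x in A, f x ∂μ)) := by
    refine tendsto_integral_of_dominated_convergence (fun x => |f x|) (fun n => ?_)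
      hf.restrict.abs (fun n => ?_) ?_
    · exact ((((measurable_birkhoffMax hT.measurable hfm n).comp hT.measurable).neg).max
        hfm).aestronglyMeasurable
    · refine .of_forall fun x => ?_
      have := birkhoffMax_nonneg (T := T) f n (T x)
      rw [Real.norm_eq_abs, abs_le]
      constructor
      · exact le_max_of_le_right (neg_abs_le _)
      · exact max_le ((neg_nonpos.2 this).trans (abs_nonneg _)) (le_abs_self _)
    · refine (ae_restrict_iff' hAm).2 (.of_forall fun x hx => ?_)
      rw [hA, ← preimage_birkhoffUnbounded] at hx
      obtain ⟨B, hB⟩ := exists_nat_gt (-f x)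
      obtain ⟨n, hn⟩ := hx B
      refine tendsto_const_nhds.congr' ?_
      filter_upwards [eventually_ge_atTop n] with m hm
      have := birkhoffMax_mono (T := T) f (T x) hm
      exact (max_eq_right (by simp only at this; linarith)).symm
  refine ge_of_tendsto' hlim fun n => ?_
  simp_rw [← birkhoffMax_succ_sub]
  have hcomp : ∫ x in A, birkhoffMax T f n (T x) ∂μ = ∫ x in A, birkhoffMax T f n x ∂μ := by
    conv_rhs => rw [← hTA.map_eq]
    rw [integral_map hTA.measurable.aemeasurable (by rw [hTA.map_eq]; exact (hint n).1)]
  have hsub := integral_sub (hint (n + 1)) ((hTA.integrable_comp (hint n).1).2 (hint n))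
  simp only [Function.comp_apply] at hsub
  rw [hsub, hcomp, sub_nonneg]
  exact integral_mono (hint _) (hint _) fun x => birkhoffMax_le_succ f n x

/-- By ergodicity the invariant set of unbounded sums is null or full, and a full set would force
the integral of `f` to be nonnegative. -/
theorem ae_bddAbove_birkhoffSum_of_integral_neg [IsProbabilityMeasure μ] (hT : Ergodic T μ)
    {f : α → ℝ} (hfm : Measurable f) (hf : Integrable f μ) (hneg : ∫ x, f x ∂μ < 0) :
    ∀ᵐ x ∂μ, ∃ B : ℕ, ∀ n, birkhoffSum T f n x ≤ B := by
  have hA := measurableSet_birkhoffUnbounded hT.measurable hfm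
  rcases hT.toPreErgodic.ae_mem_or_ae_notMem hA (preimage_birkhoffUnbounded f) with h | h
  · have := setIntegral_birkhoffUnbounded_nonneg hT.toMeasurePreserving hfm hf
    rw [Measure.restrict_eq_self_of_ae_mem h] at this
    exact absurd this (not_le.2 hneg)
  · filter_upwards [h] with x hx
    simp only [birkhoffUnbounded, Set.mem_ofPred_eq, not_forall, not_exists, not_lt] at hx
    obtain ⟨B, hB⟩ := hx
    exact ⟨B, fun n => (birkhoffSum_le_birkhoffMax f n x).trans (hB n)⟩

theorem ae_eventually_birkhoffSum_div_lt [IsProbabilityMeasure μ] (hT : Ergodic T μ)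
    {f : α → ℝ} (hfm : Measurable f) (hf : Integrable f μ) {a : ℝ} (ha : ∫ x, f x ∂μ < a) :
    ∀ᵐ x ∂μ, ∀ᶠ n : ℕ in atTop, birkhoffSum T f n x / n < a := by
  -- The sums of `f - b` are bounded by some `B`; dividing by `n`, the error `B / n` fits into the
  -- gap `a - b`.
  obtain ⟨b, hb, hba⟩ := exists_between ha
  have hneg : ∫ x, (f x - b) ∂μ < 0 := by
    rw [integral_sub hf (integrable_const _)]
    simpa using hb
  filter_upwards [ae_bddAbove_birkhoffSum_of_integral_neg hT (hfm.sub_const b)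
    (hf.sub (integrable_const b)) hneg] with x ⟨B, hB⟩
  obtain ⟨N, hN⟩ := exists_nat_gt (B / (a - b))
  filter_upwards [eventually_gt_atTop N] with n hn
  have hn0 : (0 : ℝ) < n := by exact_mod_cast (Nat.zero_le N).trans_lt hn
  have h1 : birkhoffSum T (fun x => f x - b) n x = birkhoffSum T f n x - n * b := by
    simp [birkhoffSum, Finset.sum_sub_distrib]
  have h2 := hB n
  rw [h1] at h2
  rw [div_lt_iff₀ hn0]
  have h3 : (B : ℝ) < n * (a - b) := by
    rw [div_lt_iff₀ (by linarith)] at hN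
    have : (N : ℝ) < n := by exact_mod_cast hn
    nlinarith
  linarith

/-- Birkhoff's pointwise ergodic theorem. -/
theorem ae_tendsto_birkhoffSum_div [IsProbabilityMeasure μ] (hT : Ergodic T μ)
    {f : α → ℝ} (hfm : Measurable f) (hf : Integrable f μ) :
    ∀ᵐ x ∂μ, Tendsto (fun n : ℕ => birkhoffSum T f n x / n) atTop (𝓝 (∫ x, f x ∂μ)) := by
  have h1 : ∀ k : ℕ, ∀ᵐ x ∂μ, ∀ᶠ n : ℕ in atTop,
      birkhoffSum T f n x / n < ∫ x, f x ∂μ + 1 / ((k : ℝ) + 1) := fun k =>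
    ae_eventually_birkhoffSum_div_lt hT hfm hf (by simp; positivity)
  have h2 : ∀ k : ℕ, ∀ᵐ x ∂μ, ∀ᶠ n : ℕ in atTop,
      birkhoffSum T (fun x => -f x) n x / n < -∫ x, f x ∂μ + 1 / ((k : ℝ) + 1) := fun k =>
    ae_eventually_birkhoffSum_div_lt hT hfm.neg hf.neg
      (by simp only [Pi.neg_apply, integral_neg]; simp; positivity)
  filter_upwards [ae_all_iff.2 h1, ae_all_iff.2 h2] with x hx1 hx2
  rw [Metric.tendsto_atTop']
  intro ε hε
  obtain ⟨k, hk⟩ := exists_nat_one_div_lt hε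
  obtain ⟨N, hN⟩ := ((hx1 k).and (hx2 k)).exists_forall_of_atTop
  refine ⟨N, fun n hn => ?_⟩
  obtain ⟨ha, hb⟩ := hN n hn.le
  have h3 : birkhoffSum T (fun x => -f x) n x = - birkhoffSum T f n x := by
    simp [birkhoffSum]
  rw [h3, neg_div] at hb
  rw [Real.dist_eq, abs_lt]
  constructor <;> linarith

/-- The pointwise ergodic theorem for nonnegative functions of possibly infinite integral. -/
theorem ae_tendsto_birkhoffSum_div_lintegral [IsProbabilityMeasure μ] (hT : Ergodic T μ)
    {f : α → ℝ≥0} (hfm : Measurable f) :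
    ∀ᵐ x ∂μ, Tendsto (fun n : ℕ => ((birkhoffSum T f n x : ℝ≥0) : ℝ≥0∞) / n) atTop
      (𝓝 (∫⁻ x, f x ∂μ)) := by
  have key : ∀ g : α → ℝ≥0, Measurable g → ∫⁻ x, g x ∂μ ≠ ∞ →
      ∀ᵐ x ∂μ, Tendsto (fun n : ℕ => ((birkhoffSum T g n x : ℝ≥0) : ℝ≥0∞) / n) atTop
        (𝓝 (∫⁻ x, g x ∂μ)) := by
    intro g hg hfin
    have hgi : Integrable (fun x => (g x : ℝ)) μ := by
      refine ⟨by fun_prop, ?_⟩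
      rw [hasFiniteIntegral_iff_enorm]
      simpa using hfin.lt_top
    filter_upwards [ae_tendsto_birkhoffSum_div hT (by fun_prop) hgi] with x hx
    have h4 := ENNReal.tendsto_ofReal hx
    rw [ofReal_integral_eq_lintegral_ofReal hgi (.of_forall fun x => (g x).2)] at h4
    simp only [ENNReal.ofReal_coe_nnreal] at h4
    refine h4.congr' ?_
    filter_upwards [eventually_gt_atTop 0] with n hn
    rw [ENNReal.ofReal_div_of_pos (by exact_mod_cast hn), ENNReal.ofReal_natCast]
    congr 1
    have : birkhoffSum T (fun x => (g x : ℝ)) n x = ((birkhoffSum T g n x : ℝ≥0) : ℝ) := by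
      simp [birkhoffSum]
    rw [this, ENNReal.ofReal_coe_nnreal]
  by_cases hfin : ∫⁻ x, f x ∂μ = ∞
  · rw [hfin]
    -- Truncation at height `M` reduces to finite integrals, which grow to infinity by monotone
    -- convergence, and the averages of `f` dominate the truncated ones.
    have htr : ∀ M : ℕ, ∀ᵐ x ∂μ, Tendsto
        (fun n : ℕ => ((birkhoffSum T (fun x => min (f x) M) n x : ℝ≥0) : ℝ≥0∞) / n) atTop
        (𝓝 (∫⁻ x, (min (f x) (M : ℝ≥0) : ℝ≥0) ∂μ)) := by
      intro M
      refine key _ (by fun_prop) (ne_top_of_le_ne_top (b := ∫⁻ x, (M : ℝ≥0∞) ∂μ) (by simp) ?_)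
      refine lintegral_mono fun x => ?_
      have : min (f x) (M : ℝ≥0) ≤ M := min_le_right _ _
      exact (ENNReal.coe_le_coe.2 this).trans (by simp)
    have hsup : Tendsto (fun M : ℕ => ∫⁻ x, (min (f x) (M : ℝ≥0) : ℝ≥0) ∂μ) atTop (𝓝 ∞) := by
      rw [← hfin]
      refine lintegral_tendsto_of_tendsto_of_monotone (fun n => by fun_prop)
        (.of_forall fun x => ?_) (.of_forall fun x => ?_)
      · intro a b hab
        simp only
        gcongr
      · obtain ⟨N, hN⟩ := exists_nat_ge (f x)
        refine tendsto_const_nhds.congr' ?_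
        filter_upwards [eventually_ge_atTop N] with n hn
        rw [min_eq_left (hN.trans (by exact_mod_cast hn))]
    filter_upwards [ae_all_iff.2 htr] with x hx
    rw [ENNReal.tendsto_nhds_top_iff_nat]
    intro k
    obtain ⟨M, hM⟩ := ((ENNReal.tendsto_nhds_top_iff_nat.1 hsup) k).exists
    filter_upwards [(hx M).eventually (lt_mem_nhds hM)] with n hn
    refine hn.trans_le ?_
    gcongr
    refine Finset.sum_le_sum fun i _ => min_le_left _ _
  · exact key f hfm hfin

end Birkhoff

/-! ### Percolation clusters and shifts of the environment -/

section Environment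

variable {d : ℕ}

/-- The environment seen from the site `a`. -/
def shift (a : Site d) (ω : Env d) : Env d := fun x => ω (x + a)

theorem shift_shift (a b : Site d) (ω : Env d) : shift a (shift b ω) = shift (a + b) ω := by
  funext x
  simp [shift, add_assoc]

theorem shift_zero (ω : Env d) : shift 0 ω = ω := by
  funext x
  simp [shift]

theorem iterate_shift (a : Site d) (n : ℕ) : (shift a)^[n] = shift (n • a) := by
  induction n with
  | zero => funext ω; simp [shift_zero]
  | succ n ih =>
    funext ω
    rw [Function.iterate_succ_apply', ih, shift_shift, succ_nsmul']

theorem measurable_shift (a : Site d) : Measurable (shift a) :=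
  measurable_pi_lambda _ fun x => measurable_pi_apply (x + a)

theorem measurableSet_mem_cluster (x y : Site d) :
    MeasurableSet {ω : Env d | y ∈ cluster ω x} := by
  -- A walk is determined by its list of vertices, so the union over walks is countable.
  have : Countable ((lattice d).Walk x y) := SimpleGraph.Walk.support_injective.countable
  have h : {ω : Env d | y ∈ cluster ω x} =
      ⋃ w : (lattice d).Walk x y, ⋂ u ∈ {u | u ∈ w.support}, {ω : Env d | ω u = true} := by
    ext ω
    simp [cluster]
  rw [h]
  exact .iUnion fun w => .biInter (Set.to_countable _) fun u _ =>
    measurableSet_eq_fun (measurable_pi_apply u) measurable_const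

theorem le_clusterSize_iff (ω : Env d) (x : Site d) (n : ℕ) :
    (n : ℕ∞) ≤ clusterSize ω x ↔
      ∃ s : Finset (Site d), s.card = n ∧ ∀ y ∈ s, y ∈ cluster ω x := by
  constructor
  · intro h
    obtain ⟨t, ht, htn⟩ := Set.exists_subset_encard_eq h
    have hfin : t.Finite := Set.finite_of_encard_eq_coe htn
    refine ⟨hfin.toFinset, ?_, fun y hy => ht (hfin.mem_toFinset.1 hy)⟩
    rw [hfin.encard_eq_coe_toFinset_card] at htn
    exact_mod_cast htn
  · rintro ⟨s, rfl, hs⟩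
    rw [← Set.encard_coe_eq_coe_finsetCard]
    exact Set.encard_le_encard fun y hy => hs y hy

theorem measurableSet_le_clusterSize (x : Site d) (n : ℕ) :
    MeasurableSet {ω : Env d | (n : ℕ∞) ≤ clusterSize ω x} := by
  simp only [le_clusterSize_iff, Set.ofPred_exists, Set.ofPred_and, Set.ofPred_forall]
  exact .iUnion fun s => (MeasurableSet.const _).inter
    (.biInter s.countable_toSet fun y _ => measurableSet_mem_cluster x y)

theorem measurable_clusterSize (x : Site d) :
    Measurable fun ω : Env d => clusterSize ω x := by
  refine ENat.measurable_iff.2 fun n => ?_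
  have h : (fun ω : Env d => clusterSize ω x) ⁻¹' {(n : ℕ∞)} =
      {ω | (n : ℕ∞) ≤ clusterSize ω x} \ {ω | ((n + 1 : ℕ) : ℕ∞) ≤ clusterSize ω x} := by
    ext ω
    simp only [Set.mem_preimage, Set.mem_singleton_iff, Set.mem_sdiff, Set.mem_ofPred_eq, not_le]
    constructor
    · intro h
      rw [h]
      exact ⟨le_rfl, by exact_mod_cast n.lt_succ_self⟩
    · rintro ⟨h1, h2⟩
      refine le_antisymm ?_ h1
      push_cast at h2
      exact Order.le_of_lt_add_one h2
  rw [h]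
  exact (measurableSet_le_clusterSize x n).diff (measurableSet_le_clusterSize x (n + 1))

/-- Translation by `a` as an endomorphism of the lattice. -/
def translate (a : Site d) : lattice d →g lattice d where
  toFun x := x + a
  map_rel' {x y} h := by simpa [lattice] using h

theorem add_mem_cluster_of_mem_shift {ω : Env d} {a x y : Site d}
    (h : y ∈ cluster (shift a ω) x) : y + a ∈ cluster ω (x + a) := by
  obtain ⟨w, hw⟩ := h
  change translate a y ∈ cluster ω (translate a x)
  refine ⟨w.map (translate a), fun u hu => ?_⟩
  rw [SimpleGraph.Walk.support_map, List.mem_map] at hu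
  obtain ⟨v, hv, rfl⟩ := hu
  exact hw v hv

theorem clusterSize_shift_le (ω : Env d) (a x : Site d) :
    clusterSize (shift a ω) x ≤ clusterSize ω (x + a) := by
  unfold clusterSize
  rw [← (add_left_injective a).encard_image]
  refine Set.encard_le_encard ?_
  rintro _ ⟨y, hy, rfl⟩
  exact add_mem_cluster_of_mem_shift hy

theorem clusterSize_shift (ω : Env d) (a x : Site d) :
    clusterSize (shift a ω) x = clusterSize ω (x + a) := by
  refine le_antisymm (clusterSize_shift_le ω a x) ?_
  have h := clusterSize_shift_le (shift a ω) (-a) (x + a)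
  rwa [shift_shift, neg_add_cancel, shift_zero, add_neg_cancel_right] at h

theorem cluster_mono {ω η : Env d} (h : ∀ x, ω x = true → η x = true) (x : Site d) :
    cluster ω x ⊆ cluster η x := fun _ ⟨w, hw⟩ => ⟨w, fun u hu => h u (hw u hu)⟩

/-! ### The law of the environment -/

theorem measurePreserving_shift (p : I) (a : Site d) :
    MeasurePreserving (shift a) (percLaw d p) (percLaw d p) := by
  refine ⟨measurable_shift a, ?_⟩
  have h := Measure.infinitePi_map_piCongrLeft
    (μ := fun _ : Site d => bernoulliMeasure true false p) (Equiv.addRight (-a))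
  have h2 : (MeasurableEquiv.piCongrLeft (fun _ : Site d => Bool) (Equiv.addRight (-a))
      : Env d → Env d) = shift a := by
    funext ω x
    have := Equiv.piCongrLeft_apply_apply (fun _ : Site d => Bool) (Equiv.addRight (-a)) ω (x + a)
    simpa [shift, MeasurableEquiv.coe_piCongrLeft] using this
  rw [h2] at h
  exact h

/-- The two events depend on the disjoint sets of sites `s` and `s + a`. -/
theorem indep_cylinder_preimage_shift (p : I) (a : Site d) {s : Finset (Site d)}
    (hs : ∀ x ∈ s, x + a ∉ s) {S : Set (s → Bool)} (hS : MeasurableSet S) :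
    percLaw d p (cylinder s S ∩ shift a ⁻¹' cylinder s S) =
      percLaw d p (cylinder s S) * percLaw d p (cylinder s S) := by
  classical
  have hdisj : Disjoint s (s.image (· + a)) := by
    rw [Finset.disjoint_right]
    intro y hy
    obtain ⟨x, hx, rfl⟩ := Finset.mem_image.1 hy
    exact hs x hx
  have hind := (iIndepFun_infinitePi (P := fun _ : Site d => bernoulliMeasure true false p)
    (X := fun _ => id) (fun _ => measurable_id)).indepFun_finset s (s.image (· + a)) hdisj
      (fun i => measurable_pi_apply i)
  let φ : (s.image (· + a) → Bool) → (s → Bool) :=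
    fun f x => f ⟨x + a, Finset.mem_image_of_mem _ x.2⟩
  have hφ : Measurable φ := measurable_pi_lambda _ fun x => measurable_pi_apply _
  have h := hind.measure_inter_preimage_eq_mul _ _ hS (hφ hS)
  have h2 : (percLaw d p) (shift a ⁻¹' cylinder s S) = percLaw d p (cylinder s S) :=
    (measurePreserving_shift p a).measure_preimage hS.cylinder.nullMeasurableSet
  conv_rhs => enter [2]; rw [← h2]
  exact h

/-- Mixing argument: an invariant `A` is approximated by a cylinder `B`, and a multiple of `a` moves
`B` to an independent copy that still approximates `A`. Hence `μ A` is arbitrarily close to `(μ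
A)²`. -/
theorem ergodic_shift (p : I) {a : Site d} (ha : a ≠ 0) : Ergodic (shift a) (percLaw d p) := by
  set μ := percLaw d p
  refine ⟨measurePreserving_shift p a, ⟨fun A hA hinv => ?_⟩⟩
  suffices h : μ.real A = μ.real A * μ.real A by
    have h01 : μ.real A = 0 ∨ μ.real A = 1 := by
      rcases eq_or_ne (μ.real A) 0 with h0 | h0
      · exact .inl h0
      · exact .inr (mul_left_cancel₀ h0 (by linarith))
    rw [eventuallyConst_set']
    rcases h01 with h0 | h1
    · left
      exact ae_eq_empty.2 ((measureReal_eq_zero_iff).1 h0)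
    · right
      rw [ae_eq_univ, prob_compl_eq_zero_iff hA]
      rw [measureReal_def] at h1
      exact (ENNReal.toReal_eq_one_iff _).1 h1
  by_contra hne
  set δ := |μ.real A - μ.real A * μ.real A|
  have hδ : 0 < δ := abs_pos.2 (sub_ne_zero.2 hne)
  obtain ⟨B, hB, hBA⟩ := exists_measure_symmDiff_lt_of_generateFrom_isSetRing (μ := μ)
    (isSetRing_measurableCylinders (α := fun _ : Site d => Bool))
    ⟨{Set.univ}, by simp, Set.singleton_subset_iff.2 (univ_mem_measurableCylinders _), by simp⟩
    generateFrom_measurableCylinders.symm hA (ε := ENNReal.ofReal (δ / 4))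
    (by simpa using hδ)
  obtain ⟨s, S, hS, rfl⟩ := (mem_measurableCylinders _).1 hB
  have hBm : MeasurableSet (cylinder (α := fun _ : Site d => Bool) s S) :=
    .of_mem_measurableCylinders hB
  have hAB : μ.real (symmDiff (cylinder s S) A) < δ / 4 := by
    rw [measureReal_def]
    exact (ENNReal.toReal_lt_of_lt_ofReal hBA)
  -- The multiples of `a ≠ 0` are distinct, while `s` has finitely many differences.
  obtain ⟨n, hn⟩ : ∃ n : ℕ, ∀ x ∈ s, x + n • a ∉ s := by
    classical
    have hinj : Function.Injective fun n : ℕ => n • a := by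
      intro m n hmn
      obtain ⟨i, hi⟩ := Function.ne_iff.1 ha
      have := congrFun hmn i
      simp only [Pi.smul_apply, nsmul_eq_mul, Pi.zero_apply] at this hi
      exact_mod_cast mul_right_cancel₀ hi this
    obtain ⟨n, hn⟩ := (((s ×ˢ s).image fun q => q.2 - q.1).finite_toSet.preimage
      hinj.injOn).exists_notMem
    refine ⟨n, fun x hx hxn => hn ?_⟩
    simp only [Set.mem_preimage, Finset.coe_image, Set.mem_image, Finset.mem_coe,
      Finset.mem_product]
    exact ⟨(x, x + n • a), ⟨hx, hxn⟩, by simp⟩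
  have hmp := measurePreserving_shift p (n • a)
  have hAn : shift (n • a) ⁻¹' A = A := by
    rw [← iterate_shift]
    rw [Set.preimage_iterate_eq]
    exact Function.iterate_fixed hinv n
  set B := cylinder (α := fun _ : Site d => Bool) s S
  have hBn := hmp.measurable hBm
  have hind : μ.real (B ∩ shift (n • a) ⁻¹' B) = μ.real B * μ.real B := by
    rw [measureReal_def, indep_cylinder_preimage_shift p (n • a) hn hS, ENNReal.toReal_mul]
    rfl
  have hABn : μ.real (symmDiff (shift (n • a) ⁻¹' B) A) < δ / 4 := by
    have : symmDiff (shift (n • a) ⁻¹' B) A = shift (n • a) ⁻¹' (symmDiff B A) := by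
      conv_lhs => rw [← hAn]
      rfl
    rw [this, measureReal_def,
      hmp.measure_preimage (hBm.symmDiff hA).nullMeasurableSet]
    exact hAB
  -- Each of `B` and its translate costs `δ / 4` here, and comparing `(μ B)²` with `(μ A)²` costs
  -- less than another `2 * (δ / 4)`; the total stays strictly below `δ`, a contradiction.
  have h1 : |μ.real (B ∩ shift (n • a) ⁻¹' B) - μ.real A| < δ / 4 + δ / 4 := by
    refine (abs_measureReal_sub_le_measureReal_symmDiff (hBm.inter hBn).nullMeasurableSet
      hA.nullMeasurableSet).trans_lt ?_
    refine lt_of_le_of_lt ?_ (add_lt_add hAB hABn)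
    refine (measureReal_mono ?_).trans (measureReal_union_le _ _)
    intro x
    simp only [Set.mem_symmDiff, Set.mem_inter_iff, Set.mem_union]
    tauto
  have h2 := abs_measureReal_sub_le_measureReal_symmDiff (μ := μ) hBm.nullMeasurableSet
      hA.nullMeasurableSet
  rw [hind] at h1
  have h3 : |μ.real B * μ.real B - μ.real A * μ.real A| ≤ 2 * |μ.real B - μ.real A| := by
    have : μ.real B * μ.real B - μ.real A * μ.real A =
      (μ.real B + μ.real A) * (μ.real B - μ.real A) := by ring
    rw [this, abs_mul]
    gcongr
    rw [abs_of_nonneg (by positivity)]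
    linarith [measureReal_le_one (μ := μ) (s := A), measureReal_le_one (μ := μ) (s := B)]
  have h4 : δ ≤ |μ.real B * μ.real B - μ.real A| +
      |μ.real B * μ.real B - μ.real A * μ.real A| := by
    rw [abs_sub_comm (μ.real B * μ.real B) (μ.real A)]
    exact abs_sub_le _ _ _
  linarith

/-! ### Monotonicity in the parameter -/

theorem map_and_bernoulliMeasure_prod {p q r : I} (h : (p : ℝ) = q * r) :
    ((bernoulliMeasure true false q).prod (bernoulliMeasure true false r)).map
      (fun b => b.1 && b.2) = bernoulliMeasure true false p := by
  have hm : Measurable fun b : Bool × Bool => b.1 && b.2 := measurable_of_countable _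
  have htrue : (((bernoulliMeasure true false q).prod (bernoulliMeasure true false r)).map
      (fun b => b.1 && b.2)) {true} = bernoulliMeasure true false p {true} := by
    rw [Measure.map_apply hm (measurableSet_singleton _)]
    have : (fun b : Bool × Bool => b.1 && b.2) ⁻¹' {true} = {true} ×ˢ {true} := by
      ext ⟨a, b⟩
      simp
    rw [this, Measure.prod_prod]
    simp only [bernoulliMeasure_apply _ (measurableSet_singleton _)]
    simp only [Set.mem_singleton_iff, if_true, Bool.false_eq_true, if_false]
    rw [← ENNReal.coe_mul]
    congr 1
    ext
    simpa using h.symm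
  have := Measure.isProbabilityMeasure_map (μ := (bernoulliMeasure true false q).prod
    (bernoulliMeasure true false r)) hm.aemeasurable
  refine Measure.ext_of_singleton fun b => ?_
  cases b
  · have hc : ({false} : Set Bool) = {true}ᶜ := by ext b; cases b <;> simp
    rw [hc, prob_compl_eq_one_sub (measurableSet_singleton _),
      prob_compl_eq_one_sub (measurableSet_singleton _), htrue]
  · exact htrue

/-- Coupling by thinning: keeping each `q`-open site independently with probability `p / q` produces
the law with parameter `p`, and thinning can only shrink clusters. -/
theorem ae_clusterSize_ne_top_mono {p q : I} (hpq : p < q)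
    (h : ∀ᵐ ω ∂(percLaw d q), ∀ x : Site d, clusterSize ω x ≠ ⊤) :
    ∀ᵐ ω ∂(percLaw d p), ∀ x : Site d, clusterSize ω x ≠ ⊤ := by
  have hq : (0 : ℝ) < q := p.2.1.trans_lt hpq
  let r : I := ⟨p / q, div_nonneg p.2.1 q.2.1, div_le_one_of_le₀ hpq.le q.2.1⟩
  have hr : (p : ℝ) = q * r := by
    simp only [r]
    field_simp
  let π := Measure.infinitePi fun _ : Site d =>
    (bernoulliMeasure true false q).prod (bernoulliMeasure true false r)
  have hfst : π.map (fun z x => (z x).1) = percLaw d q := by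
    rw [Measure.infinitePi_map_pi _ (f := fun _ => Prod.fst) (fun _ => measurable_fst)]
    simp [percLaw]
  have hand : π.map (fun z x => (z x).1 && (z x).2) = percLaw d p := by
    rw [Measure.infinitePi_map_pi _ (f := fun _ (b : Bool × Bool) => b.1 && b.2)
      (fun _ => measurable_of_countable _)]
    simp [percLaw, map_and_bernoulliMeasure_prod hr]
  have hms : MeasurableSet {ω : Env d | ∀ x : Site d, clusterSize ω x ≠ ⊤} := by
    simp only [Set.ofPred_forall]
    exact .iInter fun x => (measurable_clusterSize x) (MeasurableSet.of_discrete (s := {⊤}ᶜ))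
  have hm1 : Measurable fun (z : Site d → Bool × Bool) x => (z x).1 := by fun_prop
  have hm2 : Measurable fun (z : Site d → Bool × Bool) x => (z x).1 && (z x).2 :=
    measurable_pi_lambda _ fun x => (measurable_of_countable
      (fun b : Bool × Bool => b.1 && b.2)).comp (measurable_pi_apply x)
  rw [← hand, ae_map_iff hm2.aemeasurable hms]
  rw [← hfst] at h
  filter_upwards [ae_of_ae_map hm1.aemeasurable h] with z hz x
  refine ne_top_of_le_ne_top (hz x) (Set.encard_le_encard (cluster_mono (fun y hy => ?_) x))
  simp only [Bool.and_eq_true] at hy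
  exact hy.1

theorem ae_clusterSize_ne_top {p : I} (hp : p < criticalProb d) :
    ∀ᵐ ω ∂(percLaw d p), ∀ x : Site d, clusterSize ω x ≠ ⊤ := by
  obtain ⟨q, hq, hpq⟩ := lt_sSup_iff.1 hp
  exact ae_clusterSize_ne_top_mono hpq hq

end Environment

/-! ### Sequences -/

section Sequences

variable {X : Type*}

/-- Prepend a term to a sequence. -/
def seqCons (a : X) (s : ℕ → X) : ℕ → X
  | 0 => a
  | n + 1 => s n

theorem seqCons_mem_pi_range {n : ℕ} {t : ℕ → Set X} {a : X} {s : ℕ → X} :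
    seqCons a s ∈ Set.pi (Finset.range (n + 1) : Set ℕ) t ↔
      a ∈ t 0 ∧ s ∈ Set.pi (Finset.range n : Set ℕ) fun i => t (i + 1) := by
  simp only [Set.mem_pi, Finset.mem_coe, Finset.mem_range]
  constructor
  · exact fun h => ⟨h 0 n.succ_pos, fun i hi => h (i + 1) (Nat.succ_lt_succ hi)⟩
  · rintro ⟨h0, h1⟩ (_ | i) hi
    · exact h0
    · exact h1 i (Nat.lt_of_succ_lt_succ hi)

variable [MeasurableSpace X]

/-- Finite measures on sequences agree if they agree on the boxes over initial segments. -/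
theorem measure_ext_of_pi_range {μ ν : Measure (ℕ → X)} [IsFiniteMeasure μ]
    (h : ∀ (n : ℕ) (t : ℕ → Set X), (∀ i, MeasurableSet (t i)) →
      μ (Set.pi (Finset.range n : Set ℕ) t) = ν (Set.pi (Finset.range n : Set ℕ) t)) : μ = ν := by
  classical
  refine ext_of_generate_finite _ (generateFrom_squareCylinders (α := fun _ : ℕ => X)).symm
    (isPiSystem_squareCylinders (fun _ => MeasurableSpace.isPiSystem_measurableSet)
      fun _ => MeasurableSet.univ) ?_ (by simpa using h 0 (fun _ => Set.univ) (fun _ => .univ))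
  rintro _ ⟨s, t, ht, rfl⟩
  -- A finite set of coordinates is enlarged to an initial segment by adding trivial constraints.
  have hst : Set.pi (s : Set ℕ) t =
      Set.pi (Finset.range (s.sup id + 1) : Set ℕ) (s.piecewise t fun _ => Set.univ) := by
    ext x
    simp only [Set.mem_pi, Finset.mem_coe, Finset.mem_range]
    constructor
    · intro hx i _
      by_cases hi : i ∈ s
      · simpa [hi] using hx i hi
      · simp [hi]
    · intro hx i hi
      simpa [hi] using hx i (Nat.lt_succ_of_le (Finset.le_sup (f := id) hi))
  rw [hst]
  refine h _ _ fun i => ?_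
  by_cases hi : i ∈ s
  · simpa [hi] using ht i trivial
  · simp [hi]

theorem measurable_seqCons : Measurable fun z : X × (ℕ → X) => seqCons z.1 z.2 := by
  refine measurable_pi_lambda _ fun n => ?_
  cases n
  · exact measurable_fst
  · exact (measurable_pi_apply _).comp measurable_snd

theorem measurePreserving_seqCons (ν : Measure X) [IsProbabilityMeasure ν] :
    MeasurePreserving (fun z : X × (ℕ → X) => seqCons z.1 z.2)
      (ν.prod (Measure.infinitePi fun _ : ℕ => ν)) (Measure.infinitePi fun _ : ℕ => ν) := by
  refine ⟨measurable_seqCons, ?_⟩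
  have := Measure.isProbabilityMeasure_map (μ := ν.prod (Measure.infinitePi fun _ : ℕ => ν))
    measurable_seqCons.aemeasurable
  refine measure_ext_of_pi_range fun n t ht => ?_
  rw [Measure.map_apply measurable_seqCons (.pi (Set.to_countable _) fun i _ => ht i)]
  cases n with
  | zero => simp
  | succ n =>
    have h : (fun z : X × (ℕ → X) => seqCons z.1 z.2) ⁻¹'
        (Set.pi (Finset.range (n + 1) : Set ℕ) t) =
        t 0 ×ˢ Set.pi (Finset.range n : Set ℕ) fun i => t (i + 1) := by
      ext ⟨a, s⟩
      exact seqCons_mem_pi_range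
    rw [h, Measure.prod_prod, Measure.infinitePi_pi _ fun i _ => ht i,
      Measure.infinitePi_pi _ fun i _ => ht _, Finset.prod_range_succ', mul_comm]

end Sequences

/-! ### The environment seen from a random walk -/

section Skew

variable {d : ℕ} {F : Type*} [MeasurableSpace F]

/-- The skew product on environments and sequences of marked steps. -/
def skew (z : Env d × (ℕ → Site d × F)) : Env d × (ℕ → Site d × F) :=
  (shift (z.2 0).1 z.1, fun n => z.2 (n + 1))

theorem measurable_shift_uncurry : Measurable fun q : Site d × Env d => shift q.1 q.2 :=
  measurable_from_prod_countable_right fun a => measurable_shift a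

theorem measurable_skew : Measurable (skew : Env d × (ℕ → Site d × F) → _) := by
  refine Measurable.prodMk ?_ (by fun_prop)
  exact measurable_shift_uncurry.comp (f := fun z : Env d × (ℕ → Site d × F) => ((z.2 0).1, z.1))
    (by fun_prop)

/-- The law of an environment and of independent marked steps. -/
def walkLaw (p : I) (ν : Measure (Site d × F)) : Measure (Env d × (ℕ → Site d × F)) :=
  (percLaw d p).prod (Measure.infinitePi fun _ => ν)

variable (p : I) (ν : Measure (Site d × F)) [IsProbabilityMeasure ν]

instance : IsProbabilityMeasure (walkLaw p ν) := by
  unfold walkLaw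
  infer_instance

/-- Decomposition of an event according to the first step. -/
theorem walkLaw_apply_eq_lintegral {B : Set (Env d × (ℕ → Site d × F))} (hB : MeasurableSet B) :
    walkLaw p ν B = ∫⁻ a, walkLaw p ν {z | (z.1, seqCons a z.2) ∈ B} ∂ν := by
  have hmp : MeasurePreserving
      (fun z : (Site d × F) × (Env d × (ℕ → Site d × F)) => (z.2.1, seqCons z.1 z.2.2))
      (ν.prod (walkLaw p ν)) (walkLaw p ν) := by
    have h1 := ((MeasurePreserving.id (percLaw d p)).prod (measurePreserving_seqCons ν))
    have h2 := measurePreserving_prodAssoc (percLaw d p) ν (Measure.infinitePi fun _ : ℕ => ν)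
    have h3 := (Measure.measurePreserving_swap (μ := ν) (ν := percLaw d p)).prod
      (MeasurePreserving.id (Measure.infinitePi fun _ : ℕ => ν))
    have h4 := (measurePreserving_prodAssoc ν (percLaw d p)
      (Measure.infinitePi fun _ : ℕ => ν)).symm
    exact ((h1.comp h2).comp h3).comp h4
  rw [← hmp.measure_preimage hB.nullMeasurableSet,
    Measure.prod_apply (hmp.measurable hB)]
  rfl

theorem measurePreserving_shift_prod (a : Site d) :
    MeasurePreserving (fun z : Env d × (ℕ → Site d × F) => (shift a z.1, z.2))
      (walkLaw p ν) (walkLaw p ν) :=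
  (measurePreserving_shift p a).prod (MeasurePreserving.id _)

/-- Given the first step `a`, the map acts as the measure-preserving shift by `a` on the
environment, and the later steps are again i.i.d. and independent of it. -/
theorem measurePreserving_skew : MeasurePreserving skew (walkLaw p ν) (walkLaw p ν) := by
  refine ⟨measurable_skew, Measure.ext fun B hB => ?_⟩
  rw [Measure.map_apply measurable_skew hB, walkLaw_apply_eq_lintegral p ν (measurable_skew hB)]
  have h : ∀ a : Site d × F, walkLaw p ν {z | (z.1, seqCons a z.2) ∈ skew ⁻¹' B} =
      walkLaw p ν B := fun a =>
    (measurePreserving_shift_prod p ν a.1).measure_preimage hB.nullMeasurableSet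
  simp_rw [h]
  simp

variable {p ν}

/-- Conditioning on the first step and recentring the environment there leaves the invariant `A`
unchanged and removes one step constraint, at the price of translating `U`. This is the induction
step for the next lemma. -/
theorem walkLaw_inter_prod_pi_range_succ {A : Set (Env d × (ℕ → Site d × F))}
    (hA : MeasurableSet A) (hinv : skew ⁻¹' A = A) {U : Set (Env d)} (hU : MeasurableSet U)
    {V : ℕ → Set (Site d × F)} (hV : ∀ i, MeasurableSet (V i)) (n : ℕ) :
    walkLaw p ν (A ∩ U ×ˢ Set.pi (Finset.range (n + 1) : Set ℕ) V) =
      ∫⁻ a, (V 0).indicator (fun a => walkLaw p ν (A ∩ (shift (-a.1) ⁻¹' U) ×ˢ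
        Set.pi (Finset.range n : Set ℕ) fun i => V (i + 1))) a ∂ν := by
  have hpi : ∀ (n : ℕ) {V : ℕ → Set (Site d × F)}, (∀ i, MeasurableSet (V i)) →
      MeasurableSet (Set.pi (Finset.range n : Set ℕ) V) := fun n V hV =>
    .pi (Set.to_countable _) fun i _ => hV i
  rw [walkLaw_apply_eq_lintegral p ν (hA.inter (hU.prod (hpi _ hV)))]
  refine lintegral_congr fun a => ?_
  by_cases ha : a ∈ V 0
  · rw [Set.indicator_of_mem ha, ← (measurePreserving_shift_prod p ν a.1).measure_preimage
      (hA.inter (((measurable_shift _) hU).prod (hpi n fun i => hV (i + 1)))).nullMeasurableSet]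
    congr 1
    ext ⟨ω, s⟩
    have h1 : (ω, seqCons a s) ∈ A ↔ (shift a.1 ω, s) ∈ A := by
      conv_lhs => rw [← hinv]
      rfl
    have h2 : shift (-a.1) (shift a.1 ω) = ω := by rw [shift_shift, neg_add_cancel, shift_zero]
    simp only [Set.mem_ofPred_eq, Set.mem_inter_iff, Set.mem_prod, Set.mem_preimage, h1, h2,
      seqCons_mem_pi_range, ha, true_and]
  · rw [Set.indicator_of_notMem ha]
    refine measure_mono_null (t := ∅) ?_ measure_empty
    rintro ⟨ω, s⟩ ⟨_, _, h⟩
    exact ha (seqCons_mem_pi_range.1 h).1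

/-- If the conditional probability of `A` given the environment is constant, then `A` is independent
of the environment and of any finite number of initial steps. The case of no step is Fubini; `U`
varies in the induction because each step translates it. -/
theorem walkLaw_inter_prod_pi_range {A : Set (Env d × (ℕ → Site d × F))}
    (hA : MeasurableSet A) (hinv : skew ⁻¹' A = A) {c : ℝ≥0∞}
    (hc : ∀ᵐ ω ∂(percLaw d p), Measure.infinitePi (fun _ : ℕ => ν) {s | (ω, s) ∈ A} = c)
    {U : Set (Env d)} (hU : MeasurableSet U) (n : ℕ)
    {V : ℕ → Set (Site d × F)} (hV : ∀ i, MeasurableSet (V i)) :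
    walkLaw p ν (A ∩ U ×ˢ Set.pi (Finset.range n : Set ℕ) V) =
      c * walkLaw p ν (U ×ˢ Set.pi (Finset.range n : Set ℕ) V) := by
  induction n generalizing U V with
  | zero =>
    simp only [Finset.range_zero, Finset.coe_empty, Set.empty_pi]
    rw [walkLaw, Measure.prod_apply (hA.inter (hU.prod .univ)), Measure.prod_prod, measure_univ,
      mul_one, ← lintegral_indicator_const hU]
    refine lintegral_congr_ae ?_
    filter_upwards [hc] with ω hω
    by_cases h : ω ∈ U
    · rw [Set.indicator_of_mem h, ← hω]
      congr 1
      ext s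
      simp [h]
    · simp [h]
  | succ n ih =>
    have h1 := walkLaw_inter_prod_pi_range_succ (p := p) (ν := ν) MeasurableSet.univ
      Set.preimage_univ hU hV n
    simp only [Set.univ_inter] at h1
    rw [walkLaw_inter_prod_pi_range_succ hA hinv hU hV, h1]
    have hc1 : c ≠ ∞ := by
      obtain ⟨ω, hω⟩ := hc.exists
      rw [← hω]
      exact measure_ne_top _ _
    rw [← lintegral_const_mul' _ _ hc1]
    refine lintegral_congr fun a => ?_
    by_cases ha : a ∈ V 0
    · rw [Set.indicator_of_mem ha, Set.indicator_of_mem ha,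
        ih (measurable_shift _ hU) fun i => hV (i + 1)]
    · simp [ha]

/-- The previous lemma makes `A` independent of every event, hence of itself: `c = c * c`. -/
theorem walkLaw_zero_or_one {A : Set (Env d × (ℕ → Site d × F))}
    (hA : MeasurableSet A) (hinv : skew ⁻¹' A = A) {c : ℝ≥0∞}
    (hc : ∀ᵐ ω ∂(percLaw d p), Measure.infinitePi (fun _ : ℕ => ν) {s | (ω, s) ∈ A} = c) :
    walkLaw p ν A = 0 ∨ walkLaw p ν A = 1 := by
  have hc1 : c ≠ ∞ := by
    obtain ⟨ω, hω⟩ := hc.exists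
    rw [← hω]
    exact measure_ne_top _ _
  have key : (walkLaw p ν).restrict A = c • walkLaw p ν := by
    refine Measure.ext_prod @fun U W hU hW => ?_
    have h : (((walkLaw p ν).restrict A).restrict (U ×ˢ Set.univ)).map Prod.snd =
        ((c • walkLaw p ν).restrict (U ×ˢ Set.univ)).map Prod.snd := by
      refine measure_ext_of_pi_range fun n V hV => ?_
      have hpi : MeasurableSet (Set.pi (Finset.range n : Set ℕ) V) :=
        .pi (Set.to_countable _) fun i _ => hV i
      have hset : (Prod.snd ⁻¹' (Set.pi (Finset.range n : Set ℕ) V)) ∩ U ×ˢ Set.univ =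
          U ×ˢ Set.pi (Finset.range n : Set ℕ) V := by
        ext ⟨ω, s⟩
        simp only [Set.mem_inter_iff, Set.mem_preimage, Set.mem_prod, Set.mem_univ]
        tauto
      rw [Measure.map_apply measurable_snd hpi, Measure.map_apply measurable_snd hpi,
        Measure.restrict_apply (measurable_snd hpi), Measure.restrict_apply (measurable_snd hpi),
        hset, Measure.restrict_apply (hU.prod hpi), Set.inter_comm,
        walkLaw_inter_prod_pi_range hA hinv hc hU n hV]
      simp
    have h2 := congrArg (fun m => m W) h
    have hset : (Prod.snd ⁻¹' W) ∩ U ×ˢ Set.univ = U ×ˢ W := by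
      ext ⟨ω, s⟩
      simp only [Set.mem_inter_iff, Set.mem_preimage, Set.mem_prod, Set.mem_univ]
      tauto
    rwa [Measure.map_apply measurable_snd hW, Measure.map_apply measurable_snd hW,
      Measure.restrict_apply (measurable_snd hW), Measure.restrict_apply (measurable_snd hW),
      hset] at h2
  have h1 : walkLaw p ν A = c := by
    have := congrArg (fun m => m Set.univ) key
    simpa using this
  have h2 : walkLaw p ν A = c * walkLaw p ν A := by
    have := congrArg (fun m => m A) key
    simpa using this
  rw [h1] at h2 ⊢
  rcases eq_or_ne c 0 with h0 | h0
  · exact .inl h0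
  · right
    have : c * 1 = c * c := by rw [mul_one]; exact h2
    exact ((ENNReal.mul_right_inj h0 hc1).1 this).symm

/-- A bounded function on environments that is harmonic for the environment seen from a random
walk is invariant under almost all steps. -/
theorem ae_eq_shift_of_harmonic {h : Env d → ℝ} (hm : Measurable h) (hb : ∀ ω, |h ω| ≤ 1)
    (hh : ∀ᵐ ω ∂(percLaw d p), h ω = ∫ a : Site d × F, h (shift a.1 ω) ∂ν) :
    ∀ᵐ a ∂ν, h ∘ shift a.1 =ᵐ[percLaw d p] h := by
  set π := percLaw d p
  have hmv : Measurable fun q : (Site d × F) × Env d => h (shift q.1.1 q.2) :=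
    hm.comp (measurable_shift_uncurry.comp
      (f := fun q : (Site d × F) × Env d => (q.1.1, q.2)) (by fun_prop))
  have hmu : Measurable fun q : (Site d × F) × Env d => h q.2 := hm.comp measurable_snd
  have hbm : ∀ f : (Site d × F) × Env d → ℝ, Measurable f → (∀ q, |f q| ≤ 1) →
      Integrable f (ν.prod π) := fun f hf hb =>
    Integrable.of_bound hf.aestronglyMeasurable 1 (.of_forall hb)
  have hmul : ∀ x y : ℝ, |x| ≤ 1 → |y| ≤ 1 → |x * y| ≤ 1 := fun x y hx hy => by
    rw [abs_mul]
    exact mul_le_one₀ hx (abs_nonneg _) hy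
  have huu := hbm (fun q => h q.2 * h q.2) (hmu.mul hmu) fun q => hmul _ _ (hb _) (hb _)
  have huv := hbm (fun q => h q.2 * h (shift q.1.1 q.2)) (hmu.mul hmv)
    fun q => hmul _ _ (hb _) (hb _)
  have hvv := hbm (fun q => h (shift q.1.1 q.2) * h (shift q.1.1 q.2)) (hmv.mul hmv)
    fun q => hmul _ _ (hb _) (hb _)
  have iuu : ∫ q, h q.2 * h q.2 ∂(ν.prod π) = ∫ ω, h ω * h ω ∂π := by
    rw [integral_prod _ huu]
    simp
  have ivv : ∫ q, h (shift q.1.1 q.2) * h (shift q.1.1 q.2) ∂(ν.prod π) = ∫ ω, h ω * h ω ∂π := by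
    rw [integral_prod _ hvv]
    have hmm : Measurable fun ω => h ω * h ω := hm.mul hm
    have : ∀ a : Site d × F, ∫ ω, h (shift a.1 ω) * h (shift a.1 ω) ∂π = ∫ ω, h ω * h ω ∂π := by
      intro a
      conv_rhs => rw [show π = π.map (shift a.1) from (measurePreserving_shift p a.1).map_eq.symm]
      rw [integral_map (measurable_shift _).aemeasurable hmm.aestronglyMeasurable]
    simp [this]
  have iuv : ∫ q, h q.2 * h (shift q.1.1 q.2) ∂(ν.prod π) = ∫ ω, h ω * h ω ∂π := by
    rw [integral_prod_symm _ huv]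
    refine integral_congr_ae ?_
    filter_upwards [hh] with ω hω
    simp only [integral_const_mul]
    rw [← hω]
  -- Expanding the square, both square terms equal `∫ h²` by shift invariance, and harmonicity gives
  -- the cross term the same value.
  have hzero : ∫ q, (h (shift q.1.1 q.2) - h q.2) ^ 2 ∂(ν.prod π) = 0 := by
    have : ∀ q : (Site d × F) × Env d, (h (shift q.1.1 q.2) - h q.2) ^ 2 =
      h (shift q.1.1 q.2) * h (shift q.1.1 q.2) - 2 * (h q.2 * h (shift q.1.1 q.2)) +
        h q.2 * h q.2 := fun q => by ring
    simp_rw [this]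
    have hadd := integral_add (hvv.sub (huv.const_mul 2)) huu
    simp only [Pi.sub_apply] at hadd
    rw [hadd, integral_sub hvv (huv.const_mul 2),
      integral_const_mul, iuu, ivv, iuv]
    ring
  have hint : Integrable (fun q => (h (shift q.1.1 q.2) - h q.2) ^ 2) (ν.prod π) := by
    refine Integrable.of_bound ((hmv.sub hmu).pow_const 2).aestronglyMeasurable 4
      (.of_forall fun q => ?_)
    have h1 := abs_le.1 (hb (shift q.1.1 q.2))
    have h2 := abs_le.1 (hb q.2)
    rw [Real.norm_eq_abs, abs_of_nonneg (sq_nonneg _)]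
    nlinarith
  rw [integral_eq_zero_iff_of_nonneg (fun q => sq_nonneg _) hint] at hzero
  filter_upwards [Measure.ae_ae_of_ae_prod hzero] with a ha
  filter_upwards [ha] with ω hω
  exact sub_eq_zero.1 (pow_eq_zero_iff two_ne_zero |>.1 hω)

/-- The environment seen from a random walk is ergodic. -/
theorem ergodic_skew {e : Site d} (he : e ≠ 0) (hν : ν ({e} ×ˢ Set.univ) ≠ 0) :
    Ergodic skew (walkLaw p ν) := by
  refine ⟨measurePreserving_skew p ν, ⟨fun A hA hinv => ?_⟩⟩
  set ρ := Measure.infinitePi fun _ : ℕ => ν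
  -- The conditional probability of `A` given the environment; conditioning on the first step shows
  -- that it is harmonic.
  let g : Env d → ℝ≥0∞ := fun ω => ρ {s | (ω, s) ∈ A}
  have hg : Measurable g := measurable_measure_prodMk_left hA
  have hg1 : ∀ ω, g ω ≤ 1 := fun ω => prob_le_one
  have hharm : ∀ ω, g ω = ∫⁻ a : Site d × F, g (shift a.1 ω) ∂ν := by
    intro ω
    have hs : MeasurableSet {s | (ω, s) ∈ A} := measurable_prodMk_left hA
    rw [show g ω = ρ {s | (ω, s) ∈ A} from rfl,
      ← (measurePreserving_seqCons ν).measure_preimage hs.nullMeasurableSet,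
      Measure.prod_apply (measurable_seqCons hs)]
    refine lintegral_congr fun a => ?_
    change _ = ρ {s | (shift a.1 ω, s) ∈ A}
    congr 1
    ext s
    have h1 : (ω, seqCons a s) ∈ A ↔ (shift a.1 ω, s) ∈ A := by
      conv_lhs => rw [← hinv]
      rfl
    exact h1
  have hae := ae_eq_shift_of_harmonic (p := p) (ν := ν) (h := fun ω => (g ω).toReal)
    hg.ennreal_toReal
    (fun ω => by
      rw [abs_of_nonneg ENNReal.toReal_nonneg]
      exact ENNReal.toReal_mono ENNReal.one_ne_top (hg1 ω))
    (.of_forall fun ω => by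
      rw [hharm ω, integral_toReal]
      · exact (hg.comp (measurable_shift_uncurry.comp
          (f := fun a : Site d × F => (a.1, ω)) (by fun_prop))).aemeasurable
      · exact .of_forall fun a => (hg1 _).trans_lt ENNReal.one_lt_top)
  -- The step `e` has positive probability, so almost sure invariance covers it; ergodicity of the
  -- single shift by `e` then makes `g` constant.
  obtain ⟨a, ha, hae⟩ : ∃ a : Site d × F, a.1 = e ∧
      (fun ω => (g ω).toReal) ∘ shift a.1 =ᵐ[percLaw d p] fun ω => (g ω).toReal := by
    by_contra hcon
    push Not at hcon
    refine hν (measure_mono_null (fun a ha => ?_) hae)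
    exact hcon a ha.1
  rw [ha] at hae
  obtain ⟨c, hc⟩ := (ergodic_shift p he).ae_eq_const_of_ae_eq_comp_ae
    hg.ennreal_toReal.aestronglyMeasurable hae
  have h01 := walkLaw_zero_or_one (p := p) (ν := ν) hA hinv (c := ENNReal.ofReal c) (by
    filter_upwards [hc] with ω hω
    rw [← show (g ω).toReal = c from hω,
      ENNReal.ofReal_toReal (ne_top_of_le_ne_top ENNReal.one_ne_top (hg1 ω))])
  rw [eventuallyConst_set']
  rcases h01 with h0 | h1
  · exact .inl (ae_eq_empty.2 h0)
  · right
    rwa [ae_eq_univ, prob_compl_eq_zero_iff hA]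

end Skew

/-! ### The law of a chain with its holding times -/

section ChainLaw

variable {S : Type*}

/-- The chains whose first `n` states are prescribed and whose first `n` holding times lie in
prescribed sets. -/
def chainBox (n : ℕ) (x : ℕ → S) (U : ℕ → Set ℝ≥0∞) : Set (ℕ → S × ℝ≥0∞) :=
  {w | ∀ i < n, (w i).1 = x i ∧ (w i).2 ∈ U i}

/-- The measurable sets of holding times that agree on `(0, ∞]` with an interval `(t, ∞]`. -/
def tailSets : Set (Set ℝ≥0∞) :=
  {U | MeasurableSet U ∧ ∃ t : ℝ≥0, U ∩ Set.Ioi 0 = Set.Ioi (t : ℝ≥0∞)}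

/-- The boxes all of whose holding time constraints are given by `tailSets`. -/
def tailBoxes (S : Type*) : Set (Set (ℕ → S × ℝ≥0∞)) :=
  {B | ∃ (n : ℕ) (x : ℕ → S) (U : ℕ → Set ℝ≥0∞), (∀ i, U i ∈ tailSets) ∧ B = chainBox n x U}

theorem univ_mem_tailSets : Set.univ ∈ tailSets := ⟨.univ, 0, by simp⟩

theorem Ioi_mem_tailSets (t : ℝ≥0) : Set.Ioi (t : ℝ≥0∞) ∈ tailSets :=
  ⟨measurableSet_Ioi, t, Set.inter_eq_left.2 fun _ h => Set.mem_Ioi.2 (zero_le.trans_lt (Set.mem_Ioi.1 h))⟩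

theorem inter_mem_tailSets {U V : Set ℝ≥0∞} (hU : U ∈ tailSets) (hV : V ∈ tailSets) :
    U ∩ V ∈ tailSets := by
  obtain ⟨hUm, t, ht⟩ := hU
  obtain ⟨hVm, r, hr⟩ := hV
  refine ⟨hUm.inter hVm, max t r, ?_⟩
  rw [Set.inter_inter_distrib_right, ht, hr, Set.Ioi_inter_Ioi]
  simp

theorem isPiSystem_tailBoxes : IsPiSystem (tailBoxes S) := by
  rintro _ ⟨n, x, U, hU, rfl⟩ _ ⟨m, y, V, hV, rfl⟩ ⟨w, hw, hw'⟩
  -- The common point `w` supplies the prescribed states: it agrees with `x` up to `n` and with `y`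
  -- up to `m`.
  refine ⟨max n m, fun i => (w i).1, fun i => (if i < n then U i else Set.univ) ∩
    (if i < m then V i else Set.univ), fun i => inter_mem_tailSets ?_ ?_, ?_⟩
  · split_ifs
    · exact hU i
    · exact univ_mem_tailSets
  · split_ifs
    · exact hV i
    · exact univ_mem_tailSets
  · ext v
    simp only [chainBox, Set.mem_inter_iff, Set.mem_ofPred_eq] at hw hw' ⊢
    constructor
    · rintro ⟨h1, h2⟩ i hi
      by_cases hin : i < n <;> by_cases him : i < m
      · simp [hin, him, h1 i hin, h2 i him, (hw i hin).1]
      · simp [hin, him, h1 i hin, (hw i hin).1]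
      · simp [hin, him, h2 i him, (hw' i him).1]
      · omega
    · intro h
      constructor
      · intro i hi
        have := h i (lt_max_of_lt_left hi)
        simp only [hi, if_true] at this
        exact ⟨this.1.trans (hw i hi).1, this.2.1⟩
      · intro i hi
        have := h i (lt_max_of_lt_right hi)
        simp only [hi, if_true] at this
        exact ⟨this.1.trans (hw' i hi).1, this.2.2⟩

/-- Constraints on holding times alone are a union over finite words of states, a countable one when
`S` is countable. `Fin.ofNat` extends a word to all indices; only those below `n + 1` matter. -/
theorem eq_iUnion_chainBox (n : ℕ) (U : ℕ → Set ℝ≥0∞) :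
    {w : ℕ → S × ℝ≥0∞ | ∀ i < n + 1, (w i).2 ∈ U i} =
      ⋃ y : Fin (n + 1) → S, chainBox (n + 1) (fun i => y (Fin.ofNat (n + 1) i)) U := by
  ext w
  simp only [chainBox, Set.mem_ofPred_eq, Set.mem_iUnion]
  constructor
  · refine fun h => ⟨fun i => (w i).1, fun i hi => ⟨?_, h i hi⟩⟩
    simp [Nat.mod_eq_of_lt hi]
  · rintro ⟨y, h⟩ i hi
    exact (h i hi).2

variable [MeasurableSpace S] [MeasurableSingletonClass S]

theorem measurableSet_chainBox (n : ℕ) (x : ℕ → S) {U : ℕ → Set ℝ≥0∞}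
    (hU : ∀ i, MeasurableSet (U i)) : MeasurableSet (chainBox n x U) := by
  simp only [chainBox, Set.ofPred_forall, Set.ofPred_and]
  refine .iInter fun i => .iInter fun _ => .inter ?_ ?_
  · exact (measurable_fst.comp (measurable_pi_apply i)) (measurableSet_singleton (x i))
  · exact (measurable_snd.comp (measurable_pi_apply i)) (hU i)

variable [Countable S]

theorem generateFrom_tailBoxes :
    MeasurableSpace.generateFrom (tailBoxes S) = MeasurableSpace.pi := by
  refine le_antisymm (MeasurableSpace.generateFrom_le ?_) ?_
  · rintro _ ⟨n, x, U, hU, rfl⟩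
    exact measurableSet_chainBox n x fun i => (hU i).1
  · refine iSup_le fun k => ?_
    rw [← measurable_iff_comap_le]
    have hbox : ∀ (n : ℕ) (x : ℕ → S) (U : ℕ → Set ℝ≥0∞), (∀ i, U i ∈ tailSets) →
        MeasurableSet[MeasurableSpace.generateFrom (tailBoxes S)] (chainBox n x U) :=
      fun n x U hU => MeasurableSpace.measurableSet_generateFrom ⟨n, x, U, hU, rfl⟩
    let _ : MeasurableSpace (ℕ → S × ℝ≥0∞) := MeasurableSpace.generateFrom (tailBoxes S)
    have hsnd : Measurable fun w : ℕ → S × ℝ≥0∞ => (w k).2 := by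
      refine measurable_of_Ioi fun a => ?_
      induction a using ENNReal.recTopCoe with
      | top => simp
      | coe t =>
        have h : (fun w : ℕ → S × ℝ≥0∞ => (w k).2) ⁻¹' Set.Ioi (t : ℝ≥0∞) =
            {w : ℕ → S × ℝ≥0∞ | ∀ i < k + 1, (w i).2 ∈
              if i = k then Set.Ioi (t : ℝ≥0∞) else Set.univ} := by
          ext w
          simp only [Set.mem_preimage, Set.mem_ofPred_eq]
          constructor
          · intro h i _
            split_ifs with hi
            · rwa [hi]
            · trivial
          · intro h
            simpa using h k k.lt_succ_self
        rw [h, eq_iUnion_chainBox k fun i => if i = k then Set.Ioi (t : ℝ≥0∞) else Set.univ]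
        refine .iUnion fun y => hbox _ _ _ fun i => ?_
        split_ifs
        · exact Ioi_mem_tailSets t
        · exact univ_mem_tailSets
    have hfst : Measurable fun w : ℕ → S × ℝ≥0∞ => (w k).1 := by
      refine measurable_to_countable' fun a => ?_
      have h : (fun w : ℕ → S × ℝ≥0∞ => (w k).1) ⁻¹' {a} =
          ⋃ y : {y : Fin (k + 1) → S // y (Fin.ofNat (k + 1) k) = a},
            chainBox (k + 1) (fun i => y.1 (Fin.ofNat (k + 1) i)) fun _ => Set.univ := by
        have h0 := eq_iUnion_chainBox (S := S) k fun _ => Set.univ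
        ext w
        simp only [Set.mem_preimage, Set.mem_singleton_iff, Set.mem_iUnion]
        constructor
        · intro h
          have hw : w ∈ {w : ℕ → S × ℝ≥0∞ | ∀ i < k + 1, (w i).2 ∈ Set.univ} :=
            fun _ _ => trivial
          rw [h0, Set.mem_iUnion] at hw
          obtain ⟨y, hy⟩ := hw
          exact ⟨⟨y, (hy k k.lt_succ_self).1.symm.trans h⟩, hy⟩
        · rintro ⟨⟨y, hya⟩, hy⟩
          exact (hy k k.lt_succ_self).1.trans hya
      rw [h]
      exact .iUnion fun y => hbox _ _ _ fun i => univ_mem_tailSets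
    exact hfst.prodMk hsnd

/-- The law of a chain with positive holding times is determined by the joint laws of its states
and of the tails of its holding times. -/
theorem chainLaw_unique {κ₁ κ₂ : Measure (ℕ → S × ℝ≥0∞)} [IsProbabilityMeasure κ₁]
    [IsProbabilityMeasure κ₂]
    (h : ∀ (n : ℕ) (x : ℕ → S) (t : ℕ → ℝ≥0),
      κ₁ (chainBox (n + 1) x fun i => Set.Ioi (t i : ℝ≥0∞)) =
        κ₂ (chainBox (n + 1) x fun i => Set.Ioi (t i : ℝ≥0∞)))
    (hpos : ∀ᵐ w ∂κ₂, ∀ i, 0 < (w i).2) : κ₁ = κ₂ := by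
  have hsum : ∀ (κ : Measure (ℕ → S × ℝ≥0∞)) (n : ℕ),
      κ {w : ℕ → S × ℝ≥0∞ | ∀ i < n + 1, (w i).2 ∈ Set.Ioi ((0 : ℝ≥0) : ℝ≥0∞)} =
        ∑' y : Fin (n + 1) → S, κ (chainBox (n + 1) (fun i => y (Fin.ofNat (n + 1) i))
          fun _ => Set.Ioi ((0 : ℝ≥0) : ℝ≥0∞)) := by
    intro κ n
    rw [eq_iUnion_chainBox n fun _ => Set.Ioi ((0 : ℝ≥0) : ℝ≥0∞), measure_iUnion]
    · intro y z hyz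
      refine Set.disjoint_left.2 fun w hw hw' => hyz (funext fun i => ?_)
      have h1 := (hw i i.2).1
      have h2 := (hw' i i.2).1
      simpa using h1.symm.trans h2
    · exact fun y => measurableSet_chainBox _ _ fun _ => measurableSet_Ioi
  -- The hypothesis `h` only sees strict tails, so positivity under `κ₁` has to be recovered:
  -- summing the boxes with `t = 0` over all words shows that the times are positive with the same
  -- probability under both laws, namely one.
  have hpos1 : ∀ᵐ w ∂κ₁, ∀ i, 0 < (w i).2 := by
    have hn : ∀ n : ℕ, ∀ᵐ w ∂κ₁, ∀ i < n + 1, (w i).2 ∈ Set.Ioi ((0 : ℝ≥0) : ℝ≥0∞) := by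
      intro n
      have hm : MeasurableSet
          {w : ℕ → S × ℝ≥0∞ | ∀ i < n + 1, (w i).2 ∈ Set.Ioi ((0 : ℝ≥0) : ℝ≥0∞)} := by
        rw [eq_iUnion_chainBox n fun _ => Set.Ioi ((0 : ℝ≥0) : ℝ≥0∞)]
        exact .iUnion fun y => measurableSet_chainBox _ _ fun _ => measurableSet_Ioi
      have h2 : κ₂ {w : ℕ → S × ℝ≥0∞ | ∀ i < n + 1, (w i).2 ∈ Set.Ioi ((0 : ℝ≥0) : ℝ≥0∞)} = 1 := by
        rw [← prob_compl_eq_zero_iff hm]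
        filter_upwards [hpos] with w hw i _
        simpa using hw i
      rw [hsum] at h2
      have h1 : κ₁ {w : ℕ → S × ℝ≥0∞ | ∀ i < n + 1, (w i).2 ∈ Set.Ioi ((0 : ℝ≥0) : ℝ≥0∞)} = 1 := by
        rw [hsum, ← h2]
        exact tsum_congr fun y => h n _ fun _ => 0
      exact (prob_compl_eq_zero_iff hm).2 h1
    filter_upwards [ae_all_iff.2 hn] with w hw i
    simpa using hw i i i.lt_succ_self
  refine ext_of_generate_finite _ generateFrom_tailBoxes.symm isPiSystem_tailBoxes ?_ (by simp)
  rintro _ ⟨n, x, U, hU, rfl⟩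
  rcases n with _ | n
  · simp [chainBox]
  · choose t ht using fun i => (hU i).2
    -- For positive times a set of `tailSets` is indistinguishable from its interval.
    have hae : ∀ κ : Measure (ℕ → S × ℝ≥0∞), (∀ᵐ w ∂κ, ∀ i, 0 < (w i).2) →
        κ (chainBox (n + 1) x U) = κ (chainBox (n + 1) x fun i => Set.Ioi (t i : ℝ≥0∞)) := by
      intro κ hκ
      refine measure_congr ?_
      filter_upwards [hκ] with w hw
      refine propext (forall_congr' fun i => forall_congr' fun _ => and_congr_right fun _ => ?_)
      rw [show (w i).2 ∈ (fun i => Set.Ioi (t i : ℝ≥0∞)) i ↔ (w i).2 ∈ U i ∩ Set.Ioi 0 by rw [ht i]]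
      exact ⟨fun h => ⟨h, hw i⟩, fun h => h.1⟩
    rw [hae κ₁ hpos1, hae κ₂ hpos, h]

end ChainLaw

/-! ### The steps of the walk -/

section Steps

variable {d : ℕ} (ℓ : EuclideanSpace ℝ (Fin d)) (lam : ℝ)

/-- The probability of the step `e` of the skeleton walk. -/
def stepWeight (e : Site d) : ℝ := normConst ℓ lam * Real.exp (lam * dotSite ℓ e)

/-- The step law of the skeleton walk. -/
def stepLaw : Measure (Site d) :=
  ∑ e ∈ unitSteps d, ENNReal.ofReal (stepWeight ℓ lam e) • Measure.dirac e

/-- The joint law of a step of the skeleton walk and of an exponential holding time of rate 1. -/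
def markedStepLaw : Measure (Site d × ℝ) := (stepLaw ℓ lam).prod (expMeasure 1)

theorem zero_notMem_unitSteps : (0 : Site d) ∉ unitSteps d := by
  rw [mem_unitSteps]
  exact (lattice d).loopless.irrefl 0

theorem single_mem_unitSteps (k : Fin d) {ε : ℤ} (hε : |ε| = 1) :
    (Pi.single k ε : Site d) ∈ unitSteps d := by
  rw [mem_unitSteps]
  change ∑ i, |(0 : Site d) i - (Pi.single k ε : Site d) i| = 1
  rw [Finset.sum_eq_single k]
  · simpa using hε
  · intro i _ hi
    simp [hi]
  · simp

variable {ℓ lam}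

theorem normConst_pos (hd : 1 ≤ d) : 0 < normConst ℓ lam := by
  unfold normConst
  refine inv_pos.2 (Finset.sum_pos (fun e _ => Real.exp_pos _)
    ⟨_, single_mem_unitSteps (⟨0, hd⟩ : Fin d) (ε := 1) (by simp)⟩)

theorem stepWeight_pos (hd : 1 ≤ d) (e : Site d) : 0 < stepWeight ℓ lam e :=
  mul_pos (normConst_pos hd) (Real.exp_pos _)

theorem sum_stepWeight (hd : 1 ≤ d) : ∑ e ∈ unitSteps d, stepWeight ℓ lam e = 1 := by
  simp only [stepWeight]
  rw [← Finset.mul_sum]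
  have h := normConst_pos (ℓ := ℓ) (lam := lam) hd
  unfold normConst at h ⊢
  exact inv_mul_cancel₀ (inv_pos.1 h).ne'

theorem stepLaw_apply_singleton (a : Site d) :
    stepLaw ℓ lam {a} =
      if a ∈ unitSteps d then ENNReal.ofReal (stepWeight ℓ lam a) else 0 := by
  simp only [stepLaw, Measure.coe_finsetSum, Finset.sum_apply, Measure.smul_apply,
    Measure.dirac_apply' _ (measurableSet_singleton a), smul_eq_mul, Set.indicator_apply,
    Set.mem_singleton_iff, Pi.one_apply, mul_ite, mul_one, mul_zero]
  rw [Finset.sum_ite_eq']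

theorem isProbabilityMeasure_stepLaw (hd : 1 ≤ d) : IsProbabilityMeasure (stepLaw ℓ lam) := by
  constructor
  simp only [stepLaw, Measure.coe_finsetSum, Finset.sum_apply, Measure.smul_apply,
    measure_univ, smul_eq_mul, mul_one]
  rw [← ENNReal.ofReal_sum_of_nonneg fun e _ => (stepWeight_pos hd e).le, sum_stepWeight hd,
    ENNReal.ofReal_one]

theorem expMeasure_Ioi {t : ℝ} (ht : 0 ≤ t) :
    expMeasure 1 (Set.Ioi t) = ENNReal.ofReal (Real.exp (-t)) := by
  have := isProbabilityMeasure_expMeasure one_pos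
  have h := cdf_expMeasure_eq one_pos t
  rw [if_pos ht, one_mul, ProbabilityTheory.cdf_eq_real] at h
  rw [← Set.compl_Iic, prob_compl_eq_one_sub measurableSet_Iic, ← ofReal_measureReal, h,
    ← ENNReal.ofReal_one, ← ENNReal.ofReal_sub _ (by simpa using ht)]
  congr 1
  ring

/-- Layer-cake formula with the tail `e^{-t}`, applied to `max y 0` because it needs a nonnegative
function. -/
theorem lintegral_ofReal_expMeasure : ∫⁻ y, ENNReal.ofReal y ∂(expMeasure 1) = 1 := by
  have h1 : ∫⁻ y, ENNReal.ofReal y ∂(expMeasure 1) =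
      ∫⁻ y, ENNReal.ofReal (max y 0) ∂(expMeasure 1) := by
    refine lintegral_congr fun y => ?_
    rcases le_total y 0 with h | h
    · rw [max_eq_right h, ENNReal.ofReal_of_nonpos h, ENNReal.ofReal_zero]
    · rw [max_eq_left h]
  rw [h1, lintegral_eq_lintegral_meas_lt (f := fun y : ℝ => max y 0) _ (.of_forall fun y => le_max_right _ _)
    (by fun_prop)]
  have h2 : ∀ t ∈ Set.Ioi (0 : ℝ), expMeasure 1 {y | t < max y 0} =
      ENNReal.ofReal (Real.exp (-t)) := by
    intro t ht
    rw [← expMeasure_Ioi (le_of_lt ht)]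
    congr 1
    ext y
    simp only [Set.mem_ofPred_eq, Set.mem_Ioi, lt_max_iff]
    exact or_iff_left (not_lt.2 (le_of_lt ht))
  rw [setLIntegral_congr_fun measurableSet_Ioi h2,
    ← ofReal_integral_eq_lintegral_ofReal (integrableOn_exp_neg_Ioi 0)
      (.of_forall fun t => (Real.exp_pos _).le),
    integral_exp_neg_Ioi_zero, ENNReal.ofReal_one]

theorem isProbabilityMeasure_markedStepLaw (hd : 1 ≤ d) :
    IsProbabilityMeasure (markedStepLaw ℓ lam) := by
  have := isProbabilityMeasure_stepLaw (ℓ := ℓ) (lam := lam) hd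
  have := isProbabilityMeasure_expMeasure one_pos
  unfold markedStepLaw
  infer_instance

end Steps

/-! ### The generator -/

section Generator

variable {d : ℕ} {ℓ : EuclideanSpace ℝ (Fin d)} {lam β : ℝ}

theorem expSize_natCast (b : ℝ) (n : ℕ) :
    expSize b (n : ℕ∞) = ENNReal.ofReal (Real.exp (b * n)) := by
  have : (((n : ℕ∞) : ℝ≥0∞) : EReal) = ((n : ℝ) : EReal) := by
    simp
    norm_cast
  rw [expSize, this, ← EReal.coe_mul, EReal.exp_coe]

theorem toReal_expSize_neg_eq_inv {C : ℕ∞} (hC : C ≠ ⊤) (b : ℝ) :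
    (expSize (-b) C).toReal = ((expSize b C).toNNReal : ℝ)⁻¹ := by
  lift C to ℕ using hC
  rw [expSize_natCast, expSize_natCast, ENNReal.toReal_ofReal (Real.exp_pos _).le,
    ENNReal.coe_toNNReal_eq_toReal, ENNReal.toReal_ofReal (Real.exp_pos _).le, ← Real.exp_neg,
    neg_mul]

theorem toNNReal_expSize_pos {C : ℕ∞} (hC : C ≠ ⊤) (b : ℝ) : 0 < (expSize b C).toNNReal := by
  lift C to ℕ using hC
  rw [expSize_natCast]
  exact ENNReal.toNNReal_pos (by simpa using Real.exp_pos _) ENNReal.ofReal_ne_top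

theorem coe_toNNReal_expSize {C : ℕ∞} (hC : C ≠ ⊤) (b : ℝ) :
    ((expSize b C).toNNReal : ℝ≥0∞) = expSize b C := by
  lift C to ℕ using hC
  rw [expSize_natCast]
  exact ENNReal.coe_toNNReal ENNReal.ofReal_ne_top

theorem jumpRate_generator_self (hd : 1 ≤ d) (ω : Env d) (x : Site d) :
    jumpRate (generator ℓ lam β ω) x x = -(expSize (-β) (clusterSize ω x)).toReal := by
  set c := (expSize (-β) (clusterSize ω x)).toReal with hc
  have h : ∀ e ∈ unitSteps d, Real.exp (lam * dotSite ℓ e) * c *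
      ((Pi.single x 1 : Site d → ℝ) (x + e) - (Pi.single x 1 : Site d → ℝ) x) =
      -(Real.exp (lam * dotSite ℓ e) * c) := by
    intro e he
    have hne : x + e ≠ x := fun h => zero_notMem_unitSteps (by simpa [add_eq_left.1 h] using he)
    simp [hne]
  rw [jumpRate, generator, Finset.sum_congr rfl h, Finset.sum_neg_distrib, ← Finset.sum_mul,
    mul_neg, ← mul_assoc, Finset.mul_sum]
  have := sum_stepWeight (ℓ := ℓ) (lam := lam) hd
  simp only [stepWeight] at this
  rw [this, one_mul]

theorem exitRate_generator (hd : 1 ≤ d) (ω : Env d) (x : Site d) :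
    exitRate (generator ℓ lam β ω) x = (expSize (-β) (clusterSize ω x)).toReal := by
  rw [exitRate, jumpRate_generator_self hd, neg_neg]

theorem jumpRate_generator_of_ne (ω : Env d) {x y : Site d} (hxy : x ≠ y) :
    jumpRate (generator ℓ lam β ω) x y =
      (if y - x ∈ unitSteps d then stepWeight ℓ lam (y - x) else 0) *
        (expSize (-β) (clusterSize ω x)).toReal := by
  set c := (expSize (-β) (clusterSize ω x)).toReal with hc
  have h : ∀ e ∈ unitSteps d, Real.exp (lam * dotSite ℓ e) * c *
      ((Pi.single y 1 : Site d → ℝ) (x + e) - (Pi.single y 1 : Site d → ℝ) x) =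
      if y - x = e then Real.exp (lam * dotSite ℓ e) * c else 0 := by
    intro e _
    have h1 : (Pi.single y 1 : Site d → ℝ) x = 0 := Pi.single_eq_of_ne hxy _
    by_cases he : y - x = e
    · subst he
      simp [h1]
    · have hne : x + e ≠ y := fun h => he (by rw [← h]; simp)
      simp [h1, hne, he]
  rw [jumpRate, generator, Finset.sum_congr rfl h, Finset.sum_ite_eq]
  split_ifs
  · rw [stepWeight]
    ring
  · simp

/-- The cluster factor cancels between jump rate and exit rate, so the jump chain does not see the
environment. Finiteness of the cluster keeps the exit rate nonzero; otherwise the site could be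
absorbing. -/
theorem jumpProb_generator (hd : 1 ≤ d) {ω : Env d} {x : Site d} (hx : clusterSize ω x ≠ ⊤)
    (y : Site d) :
    jumpProb (generator ℓ lam β ω) x y =
      if y - x ∈ unitSteps d then stepWeight ℓ lam (y - x) else 0 := by
  have hc : (expSize (-β) (clusterSize ω x)).toReal ≠ 0 :=
    (show (0 : ℝ) < (expSize (-β) (clusterSize ω x)).toNNReal from
      toNNReal_expSize_pos hx (-β)).ne'
  rw [jumpProb, exitRate_generator hd, if_neg hc]
  by_cases hxy : x = y
  · subst hxy
    simp [zero_notMem_unitSteps]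
  · rw [if_neg hxy, jumpRate_generator_of_ne ω hxy, mul_div_assoc, div_self hc, mul_one]

end Generator

/-! ### The walk built from independent marked steps -/

section CanonicalWalk

variable {d : ℕ}

/-- The position after `n` steps. -/
def walkPos (s : ℕ → Site d × ℝ) (n : ℕ) : Site d := ∑ i ∈ Finset.range n, (s i).1

/-- The holding time at the origin. -/
def holdingAtOrigin (β : ℝ) (z : Env d × (ℕ → Site d × ℝ)) : ℝ≥0 :=
  (z.2 0).2.toNNReal * (expSize β (clusterSize z.1 0)).toNNReal

/-- The `n`-th holding time. -/
def holdingTime (β : ℝ) (ω : Env d) (s : ℕ → Site d × ℝ) (n : ℕ) : ℝ≥0 :=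
  (s n).2.toNNReal * (expSize β (clusterSize ω (walkPos s n))).toNNReal

theorem iterate_skew (n : ℕ) (z : Env d × (ℕ → Site d × ℝ)) :
    skew^[n] z = (shift (walkPos z.2 n) z.1, fun k => z.2 (k + n)) := by
  induction n with
  | zero => simp [walkPos, shift_zero]
  | succ n ih =>
    rw [Function.iterate_succ_apply', ih]
    simp only [skew, shift_shift, zero_add]
    refine Prod.ext ?_ ?_
    · simp only [walkPos, Finset.sum_range_succ]
      rw [add_comm]
    · funext k
      exact congrArg z.2 (by omega)

/-- The `i`-th iterate of `skew` recentres the environment at the walker, so the holding time at the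
origin there is the `i`-th holding time of the walk. -/
theorem birkhoffSum_holdingAtOrigin (β : ℝ) (n : ℕ) (z : Env d × (ℕ → Site d × ℝ)) :
    birkhoffSum skew (holdingAtOrigin β) n z =
      ∑ i ∈ Finset.range n, holdingTime β z.1 z.2 i := by
  refine Finset.sum_congr rfl fun i _ => ?_
  rw [iterate_skew, holdingAtOrigin, holdingTime]
  simp only [clusterSize_shift, zero_add]

theorem measurable_walkPos (n : ℕ) : Measurable fun s : ℕ → Site d × ℝ => walkPos s n := by
  unfold walkPos
  exact Finset.measurable_fun_sum _ fun i _ => (measurable_pi_apply i).fst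

theorem measurable_holdingAtOrigin (β : ℝ) :
    Measurable (holdingAtOrigin β : Env d × (ℕ → Site d × ℝ) → ℝ≥0) := by
  have h : Measurable fun z : Env d × (ℕ → Site d × ℝ) =>
      (expSize β (clusterSize z.1 0)).toNNReal :=
    (measurable_of_countable fun C : ℕ∞ => (expSize β C).toNNReal).comp
      ((measurable_clusterSize 0).comp measurable_fst)
  unfold holdingAtOrigin
  exact Measurable.mul (by fun_prop) h

theorem measurable_holdingTime (β : ℝ) (ω : Env d) (n : ℕ) :
    Measurable fun s : ℕ → Site d × ℝ => holdingTime β ω s n := by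
  have h : Measurable fun s : ℕ → Site d × ℝ =>
      (expSize β (clusterSize ω (walkPos s n))).toNNReal :=
    (measurable_of_countable fun x : Site d => (expSize β (clusterSize ω x)).toNNReal).comp
      (measurable_walkPos n)
  unfold holdingTime
  exact Measurable.mul (by fun_prop) h

/-- The sequence of states and holding times of the walk in the environment `ω`. -/
def walkChain (β : ℝ) (ω : Env d) (s : ℕ → Site d × ℝ) (n : ℕ) : Site d × ℝ≥0∞ :=
  (walkPos s n, holdingTime β ω s n)

theorem measurable_walkChain (β : ℝ) (ω : Env d) : Measurable (walkChain β ω) :=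
  measurable_pi_lambda _ fun n =>
    (measurable_walkPos n).prodMk (measurable_holdingTime β ω n).coe_nnreal_ennreal

/-- Rescales the tail to that of the unit exponential mark. A negative mark is truncated to zero,
and both sides are then false since `t ≥ 0`. -/
theorem lt_holdingTime_iff {β : ℝ} {ω : Env d} {s : ℕ → Site d × ℝ} {n : ℕ}
    (h : clusterSize ω (walkPos s n) ≠ ⊤) (t : ℝ≥0) :
    t < holdingTime β ω s n ↔
      (expSize (-β) (clusterSize ω (walkPos s n))).toReal * t < (s n).2 := by
  have hb := toNNReal_expSize_pos h β
  have hb' : (0 : ℝ) < (expSize β (clusterSize ω (walkPos s n))).toNNReal := hb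
  rw [toReal_expSize_neg_eq_inv h, holdingTime, inv_mul_lt_iff₀ hb', ← NNReal.coe_lt_coe,
    NNReal.coe_mul, Real.coe_toNNReal', mul_comm]
  rcases le_total (s n).2 0 with h0 | h0
  · rw [max_eq_right h0, mul_zero]
    constructor
    · exact fun h => absurd h (not_lt.2 t.2)
    · exact fun h => absurd (h.trans_le (mul_nonpos_of_nonneg_of_nonpos hb'.le h0)) (not_lt.2 t.2)
  · rw [max_eq_left h0]

/-- Prescribing positions `0, …, n` from the origin means prescribing `n` increments, while `n + 1`
marks are constrained; hence the step of index `n` is free. The result is a product set, whose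
probability factorises. -/
theorem walkChain_preimage_chainBox {β : ℝ} {ω : Env d} (hω : ∀ x, clusterSize ω x ≠ ⊤) (n : ℕ)
    {x : ℕ → Site d} (hx : x 0 = 0) (t : ℕ → ℝ≥0) :
    walkChain β ω ⁻¹' chainBox (n + 1) x (fun i => Set.Ioi (t i : ℝ≥0∞)) =
      Set.pi (Finset.range (n + 1) : Set ℕ) fun i =>
        (if i < n then {x (i + 1) - x i} else Set.univ) ×ˢ
          Set.Ioi ((expSize (-β) (clusterSize ω (x i))).toReal * t i) := by
  ext s
  simp only [Set.mem_preimage, chainBox, walkChain, Set.mem_ofPred_eq, Set.mem_Ioi,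
    ENNReal.coe_lt_coe, lt_holdingTime_iff (hω _), Set.mem_pi, Finset.mem_coe, Finset.mem_range,
    Set.mem_prod]
  constructor
  · intro h i hi
    refine ⟨?_, (h i hi).1 ▸ (h i hi).2⟩
    split_ifs with hin
    · have h1 := (h (i + 1) (by omega)).1
      rw [walkPos, Finset.sum_range_succ] at h1
      rw [Set.mem_singleton_iff, ← h1, ← (h i hi).1, walkPos, add_sub_cancel_left]
    · trivial
  · intro h
    have hpos : ∀ i < n + 1, walkPos s i = x i := by
      intro i
      induction i with
      | zero => intro _; rw [hx]; simp [walkPos]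
      | succ i ih =>
        intro hi
        have h1 := (h i (by omega)).1
        rw [if_pos (by omega), Set.mem_singleton_iff] at h1
        rw [walkPos, Finset.sum_range_succ, h1]
        have := ih (by omega)
        rw [walkPos] at this
        rw [this, add_sub_cancel]
    intro i hi
    refine ⟨hpos i hi, ?_⟩
    rw [hpos i hi]
    exact (h i hi).2

variable {ℓ : EuclideanSpace ℝ (Fin d)} {lam β : ℝ}

theorem map_walkChain_chainBox (hd : 1 ≤ d) {ω : Env d} (hω : ∀ x, clusterSize ω x ≠ ⊤)
    (n : ℕ) (x : ℕ → Site d) (t : ℕ → ℝ≥0) :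
    (Measure.infinitePi fun _ : ℕ => markedStepLaw ℓ lam).map (walkChain β ω)
        (chainBox (n + 1) x fun i => Set.Ioi (t i : ℝ≥0∞)) =
      if x 0 = 0 then
        ENNReal.ofReal
          ((∏ i ∈ Finset.range n, jumpProb (generator ℓ lam β ω) (x i) (x (i + 1))) *
            ∏ i ∈ Finset.range (n + 1),
              Real.exp (-exitRate (generator ℓ lam β ω) (x i) * t i))
      else 0 := by
  have := isProbabilityMeasure_stepLaw (ℓ := ℓ) (lam := lam) hd
  have := isProbabilityMeasure_expMeasure one_pos
  have := isProbabilityMeasure_markedStepLaw (ℓ := ℓ) (lam := lam) hd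
  rw [Measure.map_apply (measurable_walkChain β ω)
    (measurableSet_chainBox _ _ fun _ => measurableSet_Ioi)]
  split_ifs with hx
  · have hm : ∀ i, MeasurableSet ((if i < n then {x (i + 1) - x i} else Set.univ : Set (Site d)) ×ˢ
        Set.Ioi ((expSize (-β) (clusterSize ω (x i))).toReal * t i)) := by
      intro i
      refine MeasurableSet.prod ?_ measurableSet_Ioi
      split_ifs
      · exact measurableSet_singleton _
      · exact .univ
    rw [walkChain_preimage_chainBox hω n hx, Measure.infinitePi_pi _ fun i _ => hm i]
    have hexp : ∀ i, expMeasure 1 (Set.Ioi ((expSize (-β) (clusterSize ω (x i))).toReal * t i)) =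
        ENNReal.ofReal (Real.exp (-exitRate (generator ℓ lam β ω) (x i) * t i)) := by
      intro i
      rw [exitRate_generator hd, expMeasure_Ioi (by positivity), neg_mul]
    have hstep : ∀ i, stepLaw ℓ lam {x (i + 1) - x i} =
        ENNReal.ofReal (jumpProb (generator ℓ lam β ω) (x i) (x (i + 1))) := by
      intro i
      rw [stepLaw_apply_singleton, jumpProb_generator hd (hω _)]
      split_ifs <;> simp
    have hjump : ∀ i, 0 ≤ jumpProb (generator ℓ lam β ω) (x i) (x (i + 1)) := by
      intro i
      rw [jumpProb_generator hd (hω _)]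
      split_ifs
      · exact (stepWeight_pos hd _).le
      · exact le_rfl
    simp only [markedStepLaw, Measure.prod_prod, hexp]
    rw [Finset.prod_mul_distrib, ENNReal.ofReal_mul (Finset.prod_nonneg fun i _ => hjump i),
      ENNReal.ofReal_prod_of_nonneg fun i _ => hjump i,
      ENNReal.ofReal_prod_of_nonneg fun i _ => (Real.exp_pos _).le]
    congr 1
    -- The free step of index `n` contributes the factor one.
    rw [Finset.prod_range_succ]
    simp only [lt_self_iff_false, if_false, measure_univ, mul_one]
    refine Finset.prod_congr rfl fun i hi => ?_
    rw [if_pos (Finset.mem_range.1 hi), hstep]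
  · refine measure_mono_null (t := ∅) (fun s hs => hx ?_) measure_empty
    exact ((hs 0 n.succ_pos).1.symm.trans (by simp [walkChain, walkPos]))

theorem ae_holdingTime_pos (hd : 1 ≤ d) {ω : Env d} (hω : ∀ x, clusterSize ω x ≠ ⊤) :
    ∀ᵐ s ∂(Measure.infinitePi fun _ : ℕ => markedStepLaw ℓ lam), ∀ i, 0 < holdingTime β ω s i := by
  have := isProbabilityMeasure_stepLaw (ℓ := ℓ) (lam := lam) hd
  have := isProbabilityMeasure_expMeasure one_pos
  have := isProbabilityMeasure_markedStepLaw (ℓ := ℓ) (lam := lam) hd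
  refine ae_all_iff.2 fun i => ?_
  have hpos : ∀ᵐ a ∂(markedStepLaw ℓ lam), 0 < a.2 := by
    have h1 : ∀ᵐ y ∂(expMeasure 1), (0 : ℝ) < y := by
      refine (prob_compl_eq_zero_iff (s := Set.Ioi (0 : ℝ)) measurableSet_Ioi).2 ?_
      rw [expMeasure_Ioi le_rfl]
      simp
    exact (measurePreserving_snd (μ := stepLaw ℓ lam)
      (ν := expMeasure 1)).quasiMeasurePreserving.ae h1
  have h := (measurePreserving_eval_infinitePi
    (fun _ : ℕ => markedStepLaw ℓ lam) i).quasiMeasurePreserving.ae hpos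
  filter_upwards [h] with s hs
  rw [lt_holdingTime_iff (hω _)]
  simpa using hs

/-- The first mark has mean one and is independent of the environment. Almost sure finiteness of
clusters makes the conversion to `ℝ≥0` lossless. -/
theorem lintegral_holdingAtOrigin (hd : 1 ≤ d) {p : I}
    (hp : ∀ᵐ ω ∂(percLaw d p), ∀ x : Site d, clusterSize ω x ≠ ⊤) :
    ∫⁻ z, holdingAtOrigin β z ∂(walkLaw p (markedStepLaw ℓ lam)) =
      ∫⁻ ω, expSize β (clusterSize ω 0) ∂(percLaw d p) := by
  have := isProbabilityMeasure_stepLaw (ℓ := ℓ) (lam := lam) hd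
  have := isProbabilityMeasure_expMeasure one_pos
  have := isProbabilityMeasure_markedStepLaw (ℓ := ℓ) (lam := lam) hd
  have hm : Measurable fun ω : Env d => ((expSize β (clusterSize ω 0)).toNNReal : ℝ≥0∞) :=
    (measurable_of_countable fun C : ℕ∞ => ((expSize β C).toNNReal : ℝ≥0∞)).comp
      (measurable_clusterSize 0)
  have hs : ∫⁻ s : ℕ → Site d × ℝ, ENNReal.ofReal (s 0).2
      ∂(Measure.infinitePi fun _ : ℕ => markedStepLaw ℓ lam) = 1 := by
    have hf : Measurable fun a : Site d × ℝ => ENNReal.ofReal a.2 := by fun_prop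
    have h1 := (measurePreserving_eval_infinitePi
      (fun _ : ℕ => markedStepLaw ℓ lam) 0).lintegral_comp hf
    have h2 := (measurePreserving_snd (μ := stepLaw ℓ lam) (ν := expMeasure 1)).lintegral_comp
      ENNReal.measurable_ofReal
    rw [lintegral_ofReal_expMeasure] at h2
    exact h1.trans h2
  have hprod := lintegral_prod_mul (μ := percLaw d p)
    (ν := Measure.infinitePi fun _ : ℕ => markedStepLaw ℓ lam) hm.aemeasurable
    (g := fun s => ENNReal.ofReal (s 0).2)
    (Measurable.aemeasurable (by fun_prop))
  rw [hs, mul_one] at hprod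
  calc ∫⁻ z, holdingAtOrigin β z ∂(walkLaw p (markedStepLaw ℓ lam))
    _ = ∫⁻ ω, ((expSize β (clusterSize ω 0)).toNNReal : ℝ≥0∞) ∂(percLaw d p) := by
      rw [← hprod]
      refine lintegral_congr fun z => ?_
      rw [holdingAtOrigin, ENNReal.coe_mul, mul_comm]
      rfl
    _ = _ := by
      refine lintegral_congr_ae ?_
      filter_upwards [hp] with ω hω
      exact coe_toNNReal_expSize (hω 0) β

end CanonicalWalk

/-! ### The drift of the skeleton walk -/

section Drift

variable {d : ℕ}

theorem mem_unitSteps_iff_exists_single {e : Site d} :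
    e ∈ unitSteps d ↔ ∃ k : Fin d, e = Pi.single k 1 ∨ e = Pi.single k (-1) := by
  constructor
  · intro h
    rw [mem_unitSteps] at h
    have h' : ∑ i, |e i| = 1 := by simpa [lattice] using h
    obtain ⟨k, -, hk⟩ : ∃ k ∈ Finset.univ, |e k| ≠ 0 := by
      by_contra hcon
      push Not at hcon
      rw [Finset.sum_eq_zero hcon] at h'
      exact zero_ne_one h'
    have hsplit := Finset.add_sum_erase Finset.univ (fun i => |e i|) (Finset.mem_univ k)
    have hrest : 0 ≤ ∑ i ∈ Finset.univ.erase k, |e i| :=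
      Finset.sum_nonneg fun i _ => abs_nonneg _
    have hk1 : 1 ≤ |e k| := Int.one_le_abs (abs_ne_zero.1 hk)
    have hzero : ∑ i ∈ Finset.univ.erase k, |e i| = 0 := by omega
    have hek : |e k| = 1 := by omega
    have hi : ∀ i, i ≠ k → e i = 0 := fun i hi =>
      abs_eq_zero.1 ((Finset.sum_eq_zero_iff_of_nonneg fun i _ => abs_nonneg _).1 hzero i
        (by simpa using hi))
    have he : e = Pi.single k (e k) := by
      funext i
      by_cases h : i = k
      · subst h
        simp
      · simp [h, hi i h]
    refine ⟨k, ?_⟩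
    rcases (abs_eq zero_le_one).1 hek with h | h
    · exact .inl (h ▸ he)
    · exact .inr (h ▸ he)
  · rintro ⟨k, rfl | rfl⟩
    · exact single_mem_unitSteps k (by simp)
    · exact single_mem_unitSteps k (by simp)

theorem sum_unitSteps {M : Type*} [AddCommMonoid M] (f : Site d → M) :
    ∑ e ∈ unitSteps d, f e = ∑ k : Fin d, (f (Pi.single k 1) + f (Pi.single k (-1))) := by
  have h : unitSteps d = Finset.univ.biUnion fun k : Fin d =>
      {Pi.single k 1, Pi.single k (-1)} := by
    ext e
    simp [mem_unitSteps_iff_exists_single]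
  rw [h, Finset.sum_biUnion]
  · refine Finset.sum_congr rfl fun k _ => Finset.sum_pair fun h => ?_
    have := congrFun h k
    simp at this
  · intro k _ j _ hkj
    refine Finset.disjoint_left.2 fun e he he' => ?_
    simp only [Finset.mem_insert, Finset.mem_singleton] at he he'
    have h1 : e k ≠ 0 := by rcases he with rfl | rfl <;> simp
    have h2 : e k = 0 := by rcases he' with rfl | rfl <;> simp [hkj]
    exact h1 h2

variable {ℓ : EuclideanSpace ℝ (Fin d)} {lam : ℝ}

theorem dotSite_single (k : Fin d) (a : ℤ) : dotSite ℓ (Pi.single k a) = ℓ k * a := by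
  rw [dotSite, Finset.sum_eq_single k]
  · simp
  · intro i _ hi
    simp [hi]
  · simp

theorem normConst_eq : normConst ℓ lam = (2 * ∑ k, Real.cosh (lam * ℓ k))⁻¹ := by
  rw [normConst, sum_unitSteps, Finset.mul_sum]
  congr 1
  refine Finset.sum_congr rfl fun k _ => ?_
  rw [dotSite_single, dotSite_single, Real.cosh_eq]
  push_cast
  ring_nf

theorem sum_stepWeight_mul (k : Fin d) :
    ∑ e ∈ unitSteps d, stepWeight ℓ lam e * (e k : ℝ) = drift ℓ lam k := by
  rw [sum_unitSteps, Finset.sum_eq_single k]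
  · simp only [stepWeight, dotSite_single, Pi.single_eq_same, normConst_eq, drift,
      PiLp.smul_apply, smul_eq_mul, Real.sinh_eq]
    rw [mul_inv]
    push_cast
    ring_nf
  · intro j _ hj
    simp [hj.symm]
  · simp

theorem integrable_stepLaw (f : Site d → ℝ) : Integrable f (stepLaw ℓ lam) := by
  rw [stepLaw, integrable_finsetSum_measure]
  exact fun e _ => (integrable_dirac (by simp)).smul_measure ENNReal.ofReal_ne_top

theorem integral_stepLaw (hd : 1 ≤ d) (k : Fin d) :
    ∫ e, (e k : ℝ) ∂(stepLaw ℓ lam) = drift ℓ lam k := by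
  rw [stepLaw, integral_finsetSum_measure fun e _ =>
    (integrable_dirac (by simp)).smul_measure ENNReal.ofReal_ne_top, ← sum_stepWeight_mul k]
  refine Finset.sum_congr rfl fun e _ => ?_
  rw [integral_smul_measure, integral_dirac, ENNReal.toReal_ofReal (stepWeight_pos hd e).le,
    smul_eq_mul]

end Drift

/-! ### Laws of large numbers for the walk -/

section LawOfLargeNumbers

variable {d : ℕ} {ℓ : EuclideanSpace ℝ (Fin d)} {lam β : ℝ}

theorem ergodic_skew_markedStepLaw (hd : 1 ≤ d) (p : I) :
    Ergodic skew (walkLaw p (markedStepLaw ℓ lam)) := by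
  have := isProbabilityMeasure_stepLaw (ℓ := ℓ) (lam := lam) hd
  have := isProbabilityMeasure_expMeasure one_pos
  have := isProbabilityMeasure_markedStepLaw (ℓ := ℓ) (lam := lam) hd
  refine ergodic_skew (e := Pi.single (⟨0, hd⟩ : Fin d) 1) (by simp) ?_
  rw [markedStepLaw, Measure.prod_prod, stepLaw_apply_singleton,
    if_pos (single_mem_unitSteps _ (by simp)), measure_univ, mul_one]
  simpa using stepWeight_pos hd _

theorem ae_tendsto_walkPos (hd : 1 ≤ d) (p : I) :
    ∀ᵐ z ∂(walkLaw p (markedStepLaw ℓ lam)),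
      Tendsto (fun n : ℕ => (n : ℝ)⁻¹ • toVec (walkPos z.2 n)) atTop (𝓝 (drift ℓ lam)) := by
  have := isProbabilityMeasure_stepLaw (ℓ := ℓ) (lam := lam) hd
  have := isProbabilityMeasure_expMeasure one_pos
  have := isProbabilityMeasure_markedStepLaw (ℓ := ℓ) (lam := lam) hd
  have hmp : MeasurePreserving (fun z : Env d × (ℕ → Site d × ℝ) => (z.2 0).1)
      (walkLaw p (markedStepLaw ℓ lam)) (stepLaw ℓ lam) :=
    ((measurePreserving_fst (μ := stepLaw ℓ lam) (ν := expMeasure 1)).comp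
      (measurePreserving_eval_infinitePi (fun _ : ℕ => markedStepLaw ℓ lam) 0)).comp
      measurePreserving_snd
  have hk : ∀ k : Fin d, ∀ᵐ z ∂(walkLaw p (markedStepLaw ℓ lam)), Tendsto (fun n : ℕ =>
      birkhoffSum skew (fun z : Env d × (ℕ → Site d × ℝ) => ((z.2 0).1 k : ℝ)) n z / n)
      atTop (𝓝 (drift ℓ lam k)) := by
    intro k
    have hkm : Measurable fun x : Site d => (x k : ℝ) := measurable_of_countable _
    have hint := (hmp.integrable_comp (integrable_stepLaw fun x => (x k : ℝ)).1).2
      (integrable_stepLaw fun x => (x k : ℝ))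
    have h := ae_tendsto_birkhoffSum_div (ergodic_skew_markedStepLaw (ℓ := ℓ) (lam := lam) hd p)
      (hkm.comp hmp.measurable) hint
    have hval : ∫ z, ((fun x : Site d => (x k : ℝ)) ∘ fun z : Env d × (ℕ → Site d × ℝ) =>
        (z.2 0).1) z ∂(walkLaw p (markedStepLaw ℓ lam)) = drift ℓ lam k := by
      rw [← integral_stepLaw hd k, ← hmp.map_eq,
        integral_map hmp.measurable.aemeasurable hkm.aestronglyMeasurable]
      rfl
    rw [hval] at h
    exact h
  filter_upwards [ae_all_iff.2 hk] with z hz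
  have hpi : Tendsto (fun (n : ℕ) (k : Fin d) => (n : ℝ)⁻¹ * (walkPos z.2 n k : ℝ)) atTop
      (𝓝 fun k => drift ℓ lam k) := by
    refine tendsto_pi_nhds.2 fun k => (hz k).congr fun n => ?_
    rw [div_eq_inv_mul]
    congr 1
    simp [birkhoffSum, iterate_skew, walkPos]
  exact ((PiLp.continuous_toLp 2 fun _ : Fin d => ℝ).tendsto _).comp hpi

theorem ae_tendsto_holdingTime (hd : 1 ≤ d) {p : I}
    (hp : ∀ᵐ ω ∂(percLaw d p), ∀ x : Site d, clusterSize ω x ≠ ⊤) :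
    ∀ᵐ z ∂(walkLaw p (markedStepLaw ℓ lam)), Tendsto (fun n : ℕ =>
      (∑ i ∈ Finset.range n, (holdingTime β z.1 z.2 i : ℝ≥0∞)) / n) atTop
      (𝓝 (∫⁻ ω, expSize β (clusterSize ω 0) ∂(percLaw d p))) := by
  have := isProbabilityMeasure_markedStepLaw (ℓ := ℓ) (lam := lam) hd
  have h := ae_tendsto_birkhoffSum_div_lintegral
    (ergodic_skew_markedStepLaw (ℓ := ℓ) (lam := lam) hd p) (measurable_holdingAtOrigin β)
  rw [lintegral_holdingAtOrigin hd hp] at h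
  filter_upwards [h] with z hz
  refine hz.congr fun n => ?_
  rw [birkhoffSum_holdingAtOrigin, ENNReal.ofNNReal_finsetSum]

end LawOfLargeNumbers

/-! ### From the jump times to continuous time -/

section ContinuousTime

/-- Provides the upper half of the squeeze of `t / N t` between `S (N t) / N t` and `S (N t + 1) / N
t`. -/
theorem tendsto_succ_div_of_tendsto_div {S : ℕ → ℝ≥0∞} {m : ℝ≥0∞} (hm : m ≠ 0)
    (h : Tendsto (fun n : ℕ => S n / n) atTop (𝓝 m)) :
    Tendsto (fun n : ℕ => S (n + 1) / n) atTop (𝓝 m) := by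
  have h1 : Tendsto (fun n : ℕ => 1 + (n : ℝ≥0∞)⁻¹) atTop (𝓝 (1 + 0)) :=
    tendsto_const_nhds.add ENNReal.tendsto_inv_nat_nhds_zero
  have h2 := ENNReal.Tendsto.mul (h.comp (tendsto_add_atTop_nat 1)) (.inl hm) h1
    (.inl (by simp))
  rw [add_zero, mul_one] at h2
  refine h2.congr' ?_
  filter_upwards [eventually_gt_atTop 0] with n hn
  have hn0 : (n : ℝ≥0∞) ≠ 0 := by exact_mod_cast hn.ne'
  have hn1 : ((n + 1 : ℕ) : ℝ≥0∞) ≠ 0 := by exact_mod_cast n.succ_ne_zero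
  have h3 : 1 + (n : ℝ≥0∞)⁻¹ = ((n + 1 : ℕ) : ℝ≥0∞) * (n : ℝ≥0∞)⁻¹ := by
    push_cast
    rw [add_mul, ENNReal.mul_inv_cancel hn0 (ENNReal.natCast_ne_top n), one_mul]
  simp only [Function.comp_apply]
  rw [h3, ← mul_assoc, ENNReal.div_mul_cancel hn1 (ENNReal.natCast_ne_top _), div_eq_mul_inv]

/-- With `N t` the number of jumps up to time `t`, the quotient `Y t / t` is `(t / N t)⁻¹` times `X
(N t) / N t`. Nonzero `m` excludes explosion, finite holding times give `N t → ∞`, and `m = ∞` is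
allowed because inversion is continuous on `ℝ≥0∞`. -/
theorem tendsto_inv_smul_of_jumpChain {d : ℕ} {X : ℕ → Site d} {τ : ℕ → ℝ≥0∞}
    {v : EuclideanSpace ℝ (Fin d)} {m : ℝ≥0∞} (hm : m ≠ 0) (hτ : ∀ n, τ n ≠ ⊤)
    (hX : Tendsto (fun n : ℕ => (n : ℝ)⁻¹ • toVec (X n)) atTop (𝓝 v))
    (hS : Tendsto (fun n : ℕ => (∑ i ∈ Finset.range n, τ i) / n) atTop (𝓝 m))
    {Y : ℝ≥0 → Site d}
    (hY : ∀ (n : ℕ) (t : ℝ≥0), ∑ i ∈ Finset.range n, τ i ≤ t →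
      (t : ℝ≥0∞) < ∑ i ∈ Finset.range (n + 1), τ i → Y t = X n) :
    Tendsto (fun t : ℝ≥0 => (t : ℝ)⁻¹ • toVec (Y t)) atTop (𝓝 (m⁻¹.toReal • v)) := by
  set S : ℕ → ℝ≥0∞ := fun n => ∑ i ∈ Finset.range n, τ i with hSdef
  have hSfin : ∀ n, S n ≠ ⊤ := fun n => ENNReal.sum_ne_top.2 fun i _ => hτ i
  have hSmono : Monotone S := fun a b hab =>
    Finset.sum_le_sum_of_subset (Finset.range_mono hab)
  have hunb : ∀ t : ℝ≥0, ∃ n, (t : ℝ≥0∞) < S (n + 1) := by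
    intro t
    -- For any finite `r` in `(0, m)` the sums eventually exceed `r * n`, hence are unbounded.
    obtain ⟨r, hr0, hrm⟩ := ENNReal.lt_iff_exists_nnreal_btwn.1 (pos_iff_ne_zero.2 hm)
    have hr0' : (r : ℝ≥0∞) ≠ 0 := hr0.ne'
    have hev := (tendsto_succ_div_of_tendsto_div hm hS).eventually (lt_mem_nhds hrm)
    obtain ⟨k, hk⟩ := ENNReal.exists_nat_gt
      (ENNReal.div_ne_top (ENNReal.coe_ne_top (r := t)) hr0')
    obtain ⟨n, hn, hnk, hn0⟩ :=
      (hev.and ((eventually_ge_atTop k).and (eventually_gt_atTop 0))).exists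
    refine ⟨n, ?_⟩
    have hn0' : (n : ℝ≥0∞) ≠ 0 := by exact_mod_cast hn0.ne'
    have h1 : (r : ℝ≥0∞) * n < S (n + 1) :=
      (ENNReal.lt_div_iff_mul_lt (.inl hn0') (.inl (ENNReal.natCast_ne_top n))).1 hn
    have h2 : (t : ℝ≥0∞) < k * r :=
      (ENNReal.div_lt_iff (.inl hr0') (.inl ENNReal.coe_ne_top)).1 hk
    refine (h2.trans_le ?_).trans h1
    rw [mul_comm]
    gcongr
  classical
  let N : ℝ≥0 → ℕ := fun t => Nat.find (hunb t)
  have hN1 : ∀ t : ℝ≥0, (t : ℝ≥0∞) < S (N t + 1) := fun t => Nat.find_spec (hunb t)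
  have hN0 : ∀ t : ℝ≥0, S (N t) ≤ t := by
    intro t
    rcases Nat.eq_zero_or_pos (N t) with h | h
    · rw [h]
      simp [hSdef]
    · have := Nat.find_min (hunb t) (Nat.sub_lt h one_pos)
      rwa [not_lt, show Nat.find (hunb t) - 1 + 1 = N t from Nat.sub_add_cancel h] at this
  have hNtop : Tendsto N atTop atTop := by
    refine tendsto_atTop.2 fun k => ?_
    filter_upwards [eventually_ge_atTop (S k).toNNReal] with t ht
    have h1 : S k ≤ t := by
      rw [← ENNReal.coe_toNNReal (hSfin k)]
      exact ENNReal.coe_le_coe.2 ht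
    exact Nat.lt_succ_iff.1 (hSmono.reflect_lt (h1.trans_lt (hN1 t)))
  have hratio : Tendsto (fun t : ℝ≥0 => (t : ℝ≥0∞) / N t) atTop (𝓝 m) := by
    refine tendsto_of_tendsto_of_tendsto_of_le_of_le (hS.comp hNtop)
      ((tendsto_succ_div_of_tendsto_div hm hS).comp hNtop) (fun t => ?_) fun t => ?_
    · exact ENNReal.div_le_div_right (hN0 t) _
    · exact ENNReal.div_le_div_right (hN1 t).le _
  have hinv : Tendsto (fun t : ℝ≥0 => ((t : ℝ≥0∞) / N t)⁻¹.toReal) atTop (𝓝 m⁻¹.toReal) :=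
    (ENNReal.tendsto_toReal (ENNReal.inv_ne_top.2 hm)).comp
      (tendsto_inv_iff.2 hratio)
  refine (hinv.smul (hX.comp hNtop)).congr' ?_
  filter_upwards [hNtop.eventually (eventually_gt_atTop 0)] with t ht
  have ht' : (N t : ℝ) ≠ 0 := by exact_mod_cast ht.ne'
  rw [hY (N t) t (hN0 t) (hN1 t)]
  simp only [Function.comp_apply, ENNReal.toReal_inv, ENNReal.toReal_div, ENNReal.coe_toReal,
    ENNReal.toReal_natCast, smul_smul]
  congr 1
  rw [inv_div]
  field_simp

end ContinuousTime

/-! ### Exponential moments of the cluster size -/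

section Moments

variable {d : ℕ} {p : I} {β : ℝ}

theorem one_le_expSize (hβ : 0 ≤ β) (C : ℕ∞) : 1 ≤ expSize β C := by
  rw [expSize, EReal.one_le_exp_iff]
  exact mul_nonneg (by exact_mod_cast hβ) (EReal.coe_ennreal_nonneg _)

theorem expSize_mono (hβ : 0 ≤ β) : Monotone (expSize β) := by
  intro C D h
  refine EReal.exp_monotone (mul_le_mul_of_nonneg_left ?_ (by exact_mod_cast hβ))
  exact_mod_cast h

theorem measurable_expSize_clusterSize (x : Site d) :
    Measurable fun ω : Env d => expSize β (clusterSize ω x) :=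
  (measurable_of_countable (expSize β)).comp (measurable_clusterSize x)

theorem one_le_lintegral_expSize (hβ : 0 ≤ β) :
    1 ≤ ∫⁻ ω, expSize β (clusterSize ω 0) ∂(percLaw d p) := by
  calc (1 : ℝ≥0∞) = ∫⁻ _, 1 ∂(percLaw d p) := by simp
    _ ≤ _ := lintegral_mono fun ω => one_le_expSize hβ _

/-- The first `n` sites of a coordinate half-line. -/
def segment (k : Fin d) (n : ℕ) : Finset (Site d) :=
  (Finset.range n).image fun j : ℕ => Pi.single k (j : ℤ)

theorem single_natCast_injective (k : Fin d) :
    Function.Injective fun j : ℕ => (Pi.single k (j : ℤ) : Site d) := by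
  intro i j h
  simpa using congrFun h k

theorem segment_subset_cluster {ω : Env d} (k : Fin d) {n : ℕ}
    (h : ∀ x ∈ segment k n, ω x = true) : ∀ x ∈ segment k n, x ∈ cluster ω 0 := by
  have hopen : ∀ j < n, ω (Pi.single k (j : ℤ)) = true := fun j hj =>
    h _ (Finset.mem_image_of_mem _ (Finset.mem_range.2 hj))
  have hmem : ∀ j : ℕ, j < n → (Pi.single k (j : ℤ) : Site d) ∈ cluster ω 0 := by
    intro j
    induction j with
    | zero =>
      intro hj
      have h0 := hopen 0 hj
      simp only [Nat.cast_zero, Pi.single_zero] at h0 ⊢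
      exact ⟨.nil, by simpa using h0⟩
    | succ j ih =>
      intro hj
      obtain ⟨w, hw⟩ := ih (by omega)
      have hadj : (lattice d).Adj (Pi.single k (j : ℤ)) (Pi.single k ((j + 1 : ℕ) : ℤ)) := by
        change ∑ i, |(Pi.single k (j : ℤ) : Site d) i -
          (Pi.single k ((j + 1 : ℕ) : ℤ) : Site d) i| = 1
        rw [Finset.sum_eq_single k]
        · simp
        · intro i _ hi
          simp [hi]
        · simp
      refine ⟨w.concat hadj, fun u hu => ?_⟩
      rw [SimpleGraph.Walk.support_concat, List.mem_append,
        List.mem_singleton] at hu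
      rcases hu with hu | rfl
      · exact hw u hu
      · exact hopen _ hj
  intro x hx
  obtain ⟨j, hj, rfl⟩ := Finset.mem_image.1 hx
  exact hmem j (Finset.mem_range.1 hj)

/-- If `n` consecutive sites starting at the origin are open, they all lie in its cluster. This
keeps the tail positive, so its logarithm is genuine. -/
theorem pow_le_percLaw_le_clusterSize (hd : 1 ≤ d) (p : I) (n : ℕ) :
    (p : ℝ) ^ n ≤ (percLaw d p).real {ω | (n : ℕ∞) ≤ clusterSize ω 0} := by
  let k : Fin d := ⟨0, hd⟩
  have hcard : (segment k n).card = n := by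
    rw [segment, Finset.card_image_of_injective _ (single_natCast_injective k), Finset.card_range]
  have hbox : percLaw d p (Set.pi (segment k n : Set (Site d)) fun _ => {true}) =
      ENNReal.ofReal ((p : ℝ) ^ n) := by
    rw [percLaw, Measure.infinitePi_pi _ fun _ _ => measurableSet_singleton _,
      Finset.prod_const, hcard, bernoulliMeasure_apply _ (measurableSet_singleton _),
      ENNReal.ofReal_pow p.2.1]
    simp only [Set.mem_singleton_iff, if_true, Bool.false_eq_true, if_false]
    congr 1
    rw [ENNReal.ofReal]
    congr 1
    ext
    simp [p.2.1]
  have h := measureReal_mono (μ := percLaw d p)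
    (s₁ := Set.pi (segment k n : Set (Site d)) fun _ => {true})
    (s₂ := {ω | (n : ℕ∞) ≤ clusterSize ω 0})
    (fun ω hω => (le_clusterSize_iff ω 0 n).2 ⟨segment k n, hcard,
      segment_subset_cluster k fun x hx => hω x hx⟩)
  rwa [measureReal_def, hbox, ENNReal.toReal_ofReal (pow_nonneg p.2.1 _)] at h

theorem percLaw_le_clusterSize_pos (hd : 1 ≤ d) (hp : 0 < p) (n : ℕ) :
    0 < (percLaw d p).real {ω | (n : ℕ∞) ≤ clusterSize ω 0} :=
  (pow_pos (by exact_mod_cast hp) n).trans_le (pow_le_percLaw_le_clusterSize hd p n)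

theorem isBoundedUnder_le_log_tail :
    IsBoundedUnder (· ≤ ·) atTop fun n : ℕ => (1 / (n : ℝ)) *
      Real.log ((percLaw d p).real {ω | (n : ℕ∞) ≤ clusterSize ω 0}) :=
  isBoundedUnder_of ⟨0, fun n => mul_nonpos_of_nonneg_of_nonpos (by positivity)
    (Real.log_nonpos measureReal_nonneg measureReal_le_one)⟩

/-- The lower bound `log p` makes the real-valued `limsup` in `decayRate` meaningful rather than a
default value. -/
theorem isCoboundedUnder_le_log_tail (hd : 1 ≤ d) (hp : 0 < p) :
    IsCoboundedUnder (· ≤ ·) atTop fun n : ℕ => (1 / (n : ℝ)) *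
      Real.log ((percLaw d p).real {ω | (n : ℕ∞) ≤ clusterSize ω 0}) := by
  have hp' : (0 : ℝ) < p := hp
  refine IsBoundedUnder.isCoboundedUnder_le (isBoundedUnder_of ⟨Real.log p, fun n => ?_⟩)
  rcases Nat.eq_zero_or_pos n with rfl | hn
  -- At `n = 0` the term is zero, since `1 / 0 = 0`.
  · simpa using Real.log_nonpos p.2.1 p.2.2
  · have hn' : (0 : ℝ) < n := by exact_mod_cast hn
    have h := Real.log_le_log (pow_pos hp' n) (pow_le_percLaw_le_clusterSize hd p n)
    rw [Real.log_pow] at h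
    change Real.log p ≤ _
    rw [one_div, ← div_eq_inv_mul, le_div_iff₀ hn', mul_comm]
    exact h

/-- For `ξ < b < β` the tail exceeds `e^{-bn}` for infinitely many `n`, and Markov's inequality
bounds the moment below by `e^{(β - b) n}` for these `n`. -/
theorem lintegral_expSize_eq_top_of_decayRate_lt (hβ : 0 ≤ β)
    (hd : 1 ≤ d) (hp : 0 < p) (h : decayRate d p < β) :
    ∫⁻ ω, expSize β (clusterSize ω 0) ∂(percLaw d p) = ⊤ := by
  obtain ⟨b, hb, hbβ⟩ := exists_between h
  have hfreq := frequently_lt_of_lt_limsup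
    (isCoboundedUnder_le_log_tail (p := p) hd hp) (neg_lt.1 hb)
  refine ENNReal.eq_top_of_forall_nnreal_le fun r => ?_
  have hlim : Tendsto (fun n : ℕ => Real.exp ((β - b) * n)) atTop atTop :=
    Real.tendsto_exp_atTop.comp
      (tendsto_natCast_atTop_atTop.const_mul_atTop (sub_pos.2 hbβ))
  obtain ⟨n, hn, hnr, hn0⟩ := (hfreq.and_eventually
    ((hlim.eventually_ge_atTop (r : ℝ)).and (eventually_gt_atTop 0))).exists
  have hn0' : (0 : ℝ) < n := by exact_mod_cast hn0
  rw [one_div, ← div_eq_inv_mul, lt_div_iff₀ hn0',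
    Real.lt_log_iff_exp_lt (percLaw_le_clusterSize_pos hd hp n)] at hn
  have hmarkov : ENNReal.ofReal (Real.exp (β * n)) *
      percLaw d p {ω | (n : ℕ∞) ≤ clusterSize ω 0} ≤
      ∫⁻ ω, expSize β (clusterSize ω 0) ∂(percLaw d p) := by
    refine le_trans ?_ (mul_meas_ge_le_lintegral (measurable_expSize_clusterSize 0)
      (ENNReal.ofReal (Real.exp (β * n))))
    gcongr
    intro hω
    rw [← expSize_natCast]
    exact expSize_mono hβ hω
  refine le_trans ?_ hmarkov
  rw [← ofReal_measureReal, ← ENNReal.ofReal_mul (Real.exp_pos _).le,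
    ← ENNReal.ofReal_coe_nnreal]
  refine ENNReal.ofReal_le_ofReal (hnr.trans ?_)
  calc Real.exp ((β - b) * n) = Real.exp (β * n) * Real.exp (-b * n) := by
        rw [← Real.exp_add]
        ring_nf
    _ ≤ _ := by gcongr

/-- The first summand suffices if `C ≤ N`; otherwise the term `n = C` of the series does. -/
theorem expSize_le_add_tsum (hβ : 0 ≤ β) {C : ℕ∞} (hC : C ≠ ⊤) (N : ℕ) :
    expSize β C ≤ ENNReal.ofReal (Real.exp (β * N)) +
      ∑' n : ℕ, if N ≤ n ∧ (n : ℕ∞) ≤ C then ENNReal.ofReal (Real.exp (β * n)) else 0 := by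
  lift C to ℕ using hC
  rw [expSize_natCast]
  rcases le_total C N with h | h
  · refine le_add_right (ENNReal.ofReal_le_ofReal (Real.exp_le_exp.2 ?_))
    gcongr
  · refine le_add_left ?_
    refine le_trans ?_ (ENNReal.le_tsum C)
    rw [if_pos ⟨h, le_rfl⟩]

/-- For `β < b < ξ` the tail is at most `e^{-bn}` from some `N` on, so the expected series is
dominated by the geometric series of ratio `e^{β - b}`. -/
theorem lintegral_expSize_ne_top_of_lt_decayRate (hβ : 0 ≤ β)
    (hd : 1 ≤ d) (hp : 0 < p) (hfin : ∀ᵐ ω ∂(percLaw d p), ∀ x : Site d, clusterSize ω x ≠ ⊤)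
    (h : β < decayRate d p) :
    ∫⁻ ω, expSize β (clusterSize ω 0) ∂(percLaw d p) ≠ ⊤ := by
  obtain ⟨b, hβb, hb⟩ := exists_between h
  have hev := eventually_lt_of_limsup_lt (lt_neg.1 hb)
    (isBoundedUnder_le_log_tail (d := d) (p := p))
  obtain ⟨N, hN⟩ := (hev.and (eventually_gt_atTop 0)).exists_forall_of_atTop
  have htail : ∀ n, N ≤ n → percLaw d p {ω | (n : ℕ∞) ≤ clusterSize ω 0} ≤
      ENNReal.ofReal (Real.exp (-b * n)) := by
    intro n hn
    obtain ⟨h1, h0⟩ := hN n hn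
    have h0' : (0 : ℝ) < n := by exact_mod_cast h0
    rw [one_div, ← div_eq_inv_mul, div_lt_iff₀ h0',
      Real.log_lt_iff_lt_exp (percLaw_le_clusterSize_pos hd hp n)] at h1
    rw [← ofReal_measureReal]
    exact ENNReal.ofReal_le_ofReal h1.le
  have hms : ∀ n : ℕ, MeasurableSet {ω : Env d | N ≤ n ∧ (n : ℕ∞) ≤ clusterSize ω 0} := fun n =>
    (MeasurableSet.const _).inter (measurableSet_le_clusterSize 0 n)
  have hsum : Summable fun n : ℕ => Real.exp ((β - b) * n) := by
    have h1 : Summable fun n : ℕ => Real.exp (β - b) ^ n :=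
      summable_geometric_of_lt_one (Real.exp_pos _).le (Real.exp_lt_one_iff.2 (sub_neg.2 hβb))
    refine h1.congr fun n => ?_
    rw [← Real.exp_nat_mul, mul_comm]
  have hterm : ∀ n : ℕ, ∫⁻ ω, (if N ≤ n ∧ (n : ℕ∞) ≤ clusterSize ω 0 then
      ENNReal.ofReal (Real.exp (β * n)) else 0) ∂(percLaw d p) ≤
      ENNReal.ofReal (Real.exp ((β - b) * n)) := by
    intro n
    have hind : ∀ ω : Env d, (if N ≤ n ∧ (n : ℕ∞) ≤ clusterSize ω 0 then
        ENNReal.ofReal (Real.exp (β * n)) else 0) =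
        {ω : Env d | N ≤ n ∧ (n : ℕ∞) ≤ clusterSize ω 0}.indicator
          (fun _ => ENNReal.ofReal (Real.exp (β * n))) ω := fun ω => by
      simp [Set.indicator_apply]
    simp_rw [hind]
    rw [lintegral_indicator_const (hms n)]
    by_cases hn : N ≤ n
    · calc _ ≤ ENNReal.ofReal (Real.exp (β * n)) * ENNReal.ofReal (Real.exp (-b * n)) := by
            gcongr
            refine (measure_mono fun ω hω => ?_).trans (htail n hn)
            exact hω.2
        _ = _ := by
            rw [← ENNReal.ofReal_mul (Real.exp_pos _).le, ← Real.exp_add]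
            ring_nf
    · simp [hn]
  refine ne_top_of_le_ne_top (b := ENNReal.ofReal (Real.exp (β * N)) +
    ∑' n : ℕ, ENNReal.ofReal (Real.exp ((β - b) * n))) ?_ ?_
  · rw [← ENNReal.ofReal_tsum_of_nonneg (fun n => (Real.exp_pos _).le) hsum]
    exact ENNReal.add_ne_top.2 ⟨ENNReal.ofReal_ne_top, ENNReal.ofReal_ne_top⟩
  · calc ∫⁻ ω, expSize β (clusterSize ω 0) ∂(percLaw d p)
      _ ≤ ∫⁻ ω, (ENNReal.ofReal (Real.exp (β * N)) + ∑' n : ℕ,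
          if N ≤ n ∧ (n : ℕ∞) ≤ clusterSize ω 0 then ENNReal.ofReal (Real.exp (β * n)) else 0)
          ∂(percLaw d p) := by
        refine lintegral_mono_ae ?_
        filter_upwards [hfin] with ω hω
        exact expSize_le_add_tsum hβ (hω 0) N
      _ = ENNReal.ofReal (Real.exp (β * N)) + ∑' n : ℕ, ∫⁻ ω,
          (if N ≤ n ∧ (n : ℕ∞) ≤ clusterSize ω 0 then ENNReal.ofReal (Real.exp (β * n)) else 0)
          ∂(percLaw d p) := by
        rw [lintegral_add_left measurable_const, lintegral_const, measure_univ, mul_one,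
          lintegral_tsum fun n => (Measurable.ite (hms n) measurable_const
            measurable_const).aemeasurable]
      _ ≤ _ := by
        gcongr with n
        exact hterm n

end Moments

/-! ### The velocity -/

section Velocity

variable {d : ℕ} {p : I} {ℓ : EuclideanSpace ℝ (Fin d)} {lam β : ℝ}

theorem drift_zero : drift ℓ 0 = 0 := by
  ext k
  simp [drift]

theorem inner_drift_pos (hℓ : ‖ℓ‖ = 1) (hlam : 0 < lam) : 0 < inner ℝ (drift ℓ lam) ℓ := by
  obtain ⟨k, hk⟩ : ∃ k, ℓ k ≠ 0 := by
    by_contra hcon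
    push Not at hcon
    have : ℓ = 0 := by
      ext k
      exact hcon k
    rw [this, norm_zero] at hℓ
    exact zero_ne_one hℓ
  have hcosh : 0 < ∑ k, Real.cosh (lam * ℓ k) :=
    Finset.sum_pos (fun k _ => Real.cosh_pos _) ⟨k, Finset.mem_univ k⟩
  have hterm : ∀ x : ℝ, x ≠ 0 → 0 < x * Real.sinh (lam * x) := by
    intro x hx
    rcases lt_or_gt_of_ne hx with h | h
    · exact mul_pos_of_neg_of_neg h (Real.sinh_neg_iff.2 (mul_neg_of_pos_of_neg hlam h))
    · exact mul_pos h (Real.sinh_pos_iff.2 (mul_pos hlam h))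
  rw [drift, inner_smul_left, PiLp.inner_apply]
  refine mul_pos (by simpa using inv_pos.2 hcosh) ?_
  refine Finset.sum_pos' (fun i _ => ?_) ⟨k, Finset.mem_univ k, ?_⟩
  · by_cases hi : ℓ i = 0
    · simp [hi]
    · simpa using (hterm _ hi).le
  · simpa using hterm _ hk

theorem velocity_eq_zero (hd : 1 ≤ d) (hp : 0 < p) (hβ : 0 ≤ β)
    (h : decayRate d p < β ∨ lam = 0) : velocity p ℓ lam β = 0 := by
  rcases h with h | rfl
  · rw [velocity, lintegral_expSize_eq_top_of_decayRate_lt hβ hd hp h]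
    simp
  · rw [velocity, drift_zero, smul_zero]

theorem inner_velocity_pos (hd : 1 ≤ d) (hp : 0 < p)
    (hfin : ∀ᵐ ω ∂(percLaw d p), ∀ x : Site d, clusterSize ω x ≠ ⊤) (hℓ : ‖ℓ‖ = 1)
    (hlam : 0 < lam) (hβ : 0 ≤ β) (h : β < decayRate d p) :
    0 < inner ℝ (velocity p ℓ lam β) ℓ := by
  rw [velocity, inner_smul_left]
  refine mul_pos ?_ (inner_drift_pos hℓ hlam)
  have h0 := (zero_lt_one.trans_le (one_le_lintegral_expSize (d := d) (p := p) hβ)).ne'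
  simpa using ENNReal.toReal_pos
    (ENNReal.inv_ne_zero.2 (lintegral_expSize_ne_top_of_lt_decayRate hβ hd hp hfin h))
    (ENNReal.inv_ne_top.2 h0)

end Velocity

/-! ### The law of large numbers in continuous time -/

section Final

variable {d : ℕ}

theorem continuous_toVec : Continuous (toVec : Site d → EuclideanSpace ℝ (Fin d)) :=
  (PiLp.continuous_toLp 2 _).comp
    (continuous_pi fun k => continuous_of_discreteTopology.comp (continuous_apply k))

/-- For a right-continuous path, the velocity can be computed along a dense set of times. -/
theorem tendsto_inv_smul_iff_of_dense {D : Set ℝ≥0} (hD : Dense D) {y : ℝ≥0 → Site d}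
    (hy : ∀ t, ContinuousWithinAt y (Set.Ici t) t) (v : EuclideanSpace ℝ (Fin d)) :
    Tendsto (fun t : ℝ≥0 => (t : ℝ)⁻¹ • toVec (y t)) atTop (𝓝 v) ↔
      Tendsto (fun q : D => ((q : ℝ≥0) : ℝ)⁻¹ • toVec (y q)) (comap Subtype.val atTop) (𝓝 v) := by
  refine ⟨fun h => h.comp tendsto_comap, fun h => ?_⟩
  rw [Metric.tendsto_nhds] at h ⊢
  intro ε hε
  obtain ⟨A, hA, hAs⟩ := mem_comap.1 (h (ε / 2) (half_pos hε))
  obtain ⟨T, hT⟩ := mem_atTop_sets.1 hA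
  filter_upwards [eventually_ge_atTop T, eventually_gt_atTop 0] with t ht ht0
  -- Times of `D` decrease to `t`, and along them right-continuity carries the bound to `t`. Only
  -- the closed ball survives the limit, hence the radius `ε / 2`.
  have hcl : t ∈ closure (Set.Ioi t ∩ D) := by
    refine closure_minimal (hD.open_subset_closure_inter isOpen_Ioi) isClosed_closure ?_
    rw [closure_Ioi]
    exact Set.self_mem_Ici
  have hinv : ContinuousWithinAt (fun t : ℝ≥0 => (t : ℝ)⁻¹) (Set.Ioi t ∩ D) t :=
    (NNReal.continuous_coe.continuousAt.inv₀ (by exact_mod_cast ht0.ne')).continuousWithinAt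
  have hvec : ContinuousWithinAt (fun t : ℝ≥0 => toVec (y t)) (Set.Ioi t ∩ D) t :=
    continuous_toVec.continuousAt.comp_continuousWithinAt
      ((hy t).mono (Set.inter_subset_left.trans Set.Ioi_subset_Ici_self))
  have hmaps : Set.MapsTo (fun t : ℝ≥0 => (t : ℝ)⁻¹ • toVec (y t)) (Set.Ioi t ∩ D)
      (Metric.closedBall v (ε / 2)) := by
    intro q hq
    have hqA : (⟨q, hq.2⟩ : D) ∈ Subtype.val ⁻¹' A := hT q (ht.trans (le_of_lt hq.1))
    have h1 := hAs hqA
    rw [Set.mem_ofPred_eq] at h1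
    exact Metric.mem_closedBall.2 h1.le
  have hmem := (hinv.smul hvec).mem_closure hcl hmaps
  rw [Metric.isClosed_closedBall.closure_eq, Metric.mem_closedBall] at hmem
  exact hmem.trans_lt (half_lt_self hε)

/-- A limit over a countable dense set of times involves countably many measurable maps.
Measurability is what allows almost sure statements for `quenched ω` to be integrated over `ω`. -/
theorem measurableSet_tendsto_inv_smul {Ω' : Type*} [MeasurableSpace Ω'] {Y : ℝ≥0 → Ω' → Site d}
    (hY : ∀ t, Measurable (Y t)) (hcont : ∀ z t, ContinuousWithinAt (fun s => Y s z) (Set.Ici t) t)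
    (v : EuclideanSpace ℝ (Fin d)) :
    MeasurableSet {z | Tendsto (fun t : ℝ≥0 => (t : ℝ)⁻¹ • toVec (Y t z)) atTop (𝓝 v)} := by
  obtain ⟨D, hDc, hD⟩ := TopologicalSpace.exists_countable_dense ℝ≥0
  have : Countable D := hDc
  simp_rw [fun z => tendsto_inv_smul_iff_of_dense hD (hcont z) v]
  refine measurableSet_tendsto (𝓝 v) fun q => ?_
  have h : Measurable fun z => toVec (Y q z) := (measurable_of_countable toVec).comp (hY q)
  exact h.const_smul ((q : ℝ≥0) : ℝ)⁻¹

/-- The chains whose states have velocity `v` with respect to the number of jumps and whose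
finite holding times have mean `m`. -/
def regularChains (v : EuclideanSpace ℝ (Fin d)) (m : ℝ≥0∞) : Set (ℕ → Site d × ℝ≥0∞) :=
  {w | Tendsto (fun n : ℕ => (n : ℝ)⁻¹ • toVec (w n).1) atTop (𝓝 v)} ∩
    {w | Tendsto (fun n : ℕ => (∑ i ∈ Finset.range n, (w i).2) / n) atTop (𝓝 m)} ∩
    {w | ∀ n, (w n).2 ≠ ⊤}

theorem measurableSet_regularChains (v : EuclideanSpace ℝ (Fin d)) (m : ℝ≥0∞) :
    MeasurableSet (regularChains v m) := by
  refine ((measurableSet_tendsto _ fun n => ?_).inter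
    (measurableSet_tendsto _ fun n => ?_)).inter ?_
  · have h : Measurable fun w : ℕ → Site d × ℝ≥0∞ => toVec (w n).1 :=
      (measurable_of_countable toVec).comp (measurable_pi_apply n).fst
    exact h.const_smul (n : ℝ)⁻¹
  · have h : Measurable fun w : ℕ → Site d × ℝ≥0∞ => ∑ i ∈ Finset.range n, (w i).2 :=
      Finset.measurable_fun_sum _ fun i _ => (measurable_pi_apply i).snd
    exact h.div_const _
  · simp only [Set.ofPred_forall]
    exact .iInter fun n => measurable_snd.comp (measurable_pi_apply n)
      (measurableSet_singleton ⊤).compl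

variable {ℓ : EuclideanSpace ℝ (Fin d)} {lam β : ℝ}

theorem ae_map_walkChain_mem_regularChains (hd : 1 ≤ d) {p : I}
    (hp : ∀ᵐ ω ∂(percLaw d p), ∀ x : Site d, clusterSize ω x ≠ ⊤) :
    ∀ᵐ ω ∂(percLaw d p), ∀ᵐ w ∂((Measure.infinitePi fun _ : ℕ => markedStepLaw ℓ lam).map
      (walkChain β ω)), w ∈ regularChains (drift ℓ lam)
        (∫⁻ ω, expSize β (clusterSize ω 0) ∂(percLaw d p)) := by
  have := isProbabilityMeasure_markedStepLaw (ℓ := ℓ) (lam := lam) hd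
  have h := (ae_tendsto_walkPos (ℓ := ℓ) (lam := lam) hd p).and
    (ae_tendsto_holdingTime (ℓ := ℓ) (lam := lam) (β := β) hd hp)
  filter_upwards [Measure.ae_ae_of_ae_prod h] with ω hω
  refine (ae_map_iff (measurable_walkChain β ω).aemeasurable
    (by simpa using measurableSet_regularChains _ _)).2 ?_
  filter_upwards [hω] with s hs
  exact ⟨hs, fun n => ENNReal.coe_ne_top⟩

/-- The law of the states and holding times of a Markov jump process generated by the generator
of the walk. -/
theorem map_chain_eq_map_walkChain (hd : 1 ≤ d) {ω : Env d} (hω : ∀ x, clusterSize ω x ≠ ⊤)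
    {Ω' : Type*} [MeasurableSpace Ω'] {μ : Measure Ω'} [IsProbabilityMeasure μ]
    {X : ℕ → Ω' → Site d} {τ : ℕ → Ω' → ℝ≥0∞} (hX : ∀ n, Measurable (X n))
    (hτ : ∀ n, Measurable (τ n))
    (h : ∀ (n : ℕ) (x : ℕ → Site d) (t : ℕ → ℝ≥0),
      μ {z | ∀ i ≤ n, X i z = x i ∧ (t i : ℝ≥0∞) < τ i z} =
        if x 0 = 0 then
          ENNReal.ofReal
            ((∏ i ∈ Finset.range n, jumpProb (generator ℓ lam β ω) (x i) (x (i + 1))) *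
              ∏ i ∈ Finset.range (n + 1),
                Real.exp (-exitRate (generator ℓ lam β ω) (x i) * t i))
        else 0) :
    μ.map (fun z n => (X n z, τ n z)) =
      (Measure.infinitePi fun _ : ℕ => markedStepLaw ℓ lam).map (walkChain β ω) := by
  have := isProbabilityMeasure_markedStepLaw (ℓ := ℓ) (lam := lam) hd
  have hm : Measurable fun z n => (X n z, τ n z) :=
    measurable_pi_lambda _ fun n => (hX n).prodMk (hτ n)
  have := Measure.isProbabilityMeasure_map (μ := μ) hm.aemeasurable
  have := Measure.isProbabilityMeasure_map
    (μ := Measure.infinitePi fun _ : ℕ => markedStepLaw ℓ lam)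
    (measurable_walkChain β ω).aemeasurable
  refine chainLaw_unique (fun n x t => ?_) ?_
  · rw [map_walkChain_chainBox hd hω, ← h n x t,
      Measure.map_apply hm (measurableSet_chainBox _ _ fun _ => measurableSet_Ioi)]
    congr 1
    ext z
    simp [chainBox]
  · rw [ae_map_iff (measurable_walkChain β ω).aemeasurable]
    · filter_upwards [ae_holdingTime_pos (ℓ := ℓ) (lam := lam) (β := β) hd hω] with s hs i
      exact ENNReal.coe_pos.2 (hs i)
    · simp only [Set.ofPred_forall]
      exact .iInter fun n => measurableSet_lt measurable_const (measurable_pi_apply n).snd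

/-- For almost every `ω` the given chain has the law of the explicit one, so it is almost surely
regular; the rest is deterministic, path by path. -/
theorem ae_tendsto_of_isMarkovJumpProcess (hd : 1 ≤ d) {p : I} (hβ : 0 ≤ β)
    (hp : ∀ᵐ ω ∂(percLaw d p), ∀ x : Site d, clusterSize ω x ≠ ⊤)
    {Ω' : Type*} [MeasurableSpace Ω'] (quenched : Kernel (Env d) Ω') [IsMarkovKernel quenched]
    {Y : ℝ≥0 → Ω' → Site d} (hY : ∀ t, Measurable (Y t))
    (hcont : ∀ z t, ContinuousWithinAt (fun s => Y s z) (Set.Ici t) t)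
    (hmjp : ∀ᵐ ω ∂(percLaw d p),
      IsMarkovJumpProcess (generator ℓ lam β ω) 0 (quenched ω) Y) :
    ∀ᵐ z ∂((percLaw d p) ⊗ₘ quenched),
      Tendsto (fun t : ℝ≥0 => (t : ℝ)⁻¹ • toVec (Y t z.2)) atTop
        (𝓝 (velocity p ℓ lam β)) := by
  refine Measure.ae_compProd_of_ae_ae
    (measurable_snd (measurableSet_tendsto_inv_smul hY hcont _)) ?_
  filter_upwards [hp, hmjp, ae_map_walkChain_mem_regularChains (ℓ := ℓ) (lam := lam) (β := β) hd hp]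
    with ω hω hω' hreg
  obtain ⟨X, τ, hX, hτ, hlaw, hpath⟩ := hω'.exists_chain
  rw [← map_chain_eq_map_walkChain hd hω hX hτ hlaw] at hreg
  have hm : Measurable fun z n => (X n z, τ n z) :=
    measurable_pi_lambda _ fun n => (hX n).prodMk (hτ n)
  filter_upwards [ae_of_ae_map hm.aemeasurable hreg, hpath] with z hz hYz
  exact tendsto_inv_smul_of_jumpChain
    (zero_lt_one.trans_le (one_le_lintegral_expSize hβ)).ne' hz.2 hz.1.1 hz.1.2 hYz

end Final

end PercolationWalk

end

theorem theorem1 (d : ℕ) (hd : 1 ≤ d) (p : I) (hp0 : 0 < p)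
    (hpc : p < PercolationWalk.criticalProb d)
    (ℓ : EuclideanSpace ℝ (Fin d)) (hℓ : ‖ℓ‖ = 1)
    (lam β : ℝ) (hlam : 0 ≤ lam) (hβ : 0 ≤ β) :
    (∀ {Ω' : Type*} [MeasurableSpace Ω']
      (quenched : Kernel (PercolationWalk.Env d) Ω') [IsMarkovKernel quenched]
      (Y : ℝ≥0 → Ω' → PercolationWalk.Site d),
      (∀ t, Measurable (Y t)) →
      (∀ z t, ContinuousWithinAt (fun s => Y s z) (Set.Ici t) t) →
      (∀ᵐ ω ∂(PercolationWalk.percLaw d p), PercolationWalk.IsMarkovJumpProcess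
        (PercolationWalk.generator ℓ lam β ω) 0 (quenched ω) Y) →
      ∀ᵐ z ∂((PercolationWalk.percLaw d p) ⊗ₘ quenched),
        Tendsto (fun t : ℝ≥0 => (t : ℝ)⁻¹ • PercolationWalk.toVec (Y t z.2)) atTop
          (𝓝 (PercolationWalk.velocity p ℓ lam β))) ∧
    (PercolationWalk.decayRate d p < β ∨ lam = 0 → PercolationWalk.velocity p ℓ lam β = 0) ∧
    (β < PercolationWalk.decayRate d p → lam ≠ 0 →
      0 < inner ℝ (PercolationWalk.velocity p ℓ lam β) ℓ) := by
  have hfin := PercolationWalk.ae_clusterSize_ne_top hpc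
  refine ⟨fun quenched _ Y hY hcont hmjp => ?_, fun h => ?_, fun h hlam0 => ?_⟩
  · exact PercolationWalk.ae_tendsto_of_isMarkovJumpProcess hd hβ hfin quenched hY hcont hmjp
  · exact PercolationWalk.velocity_eq_zero hd hp0 hβ h
  · exact PercolationWalk.inner_velocity_pos hd hp0 hfin hℓ (hlam.lt_of_ne' hlam0) hβ h
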